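/- Sites and query objects are points of the Euclidean plane or open non-degenerate axes-aligned line segments (parallel to the $x$-axis or to the $y$-axis); a point is given by its two coordinates and a segment by the four coordinates of its endpoints. Let $S_1,S_2,S_3$ be pairwise disjoint sites. A circle (of positive radius) is the Voronoi circle $V(S_1,S_2,S_3)$ if it passes through each $S_i$ that is a point, is tangent to each $S_i$ that is a segment (the point of tangency lying on the closed segment), and if the sites are met in the cyclic order $S_1,S_2,S_3$ when the circle is traversed counterclockwise. (If exactly two of the points of contact coincide, then the two sites lie on a common tangent line of the circle, and their mutual order is their order along this line in the direction of the traversal; the case that all three points of contact coincide is excluded.) Whenever $V(S_1,S_2,S_3)$ exists, let $D$ be the closed disk that it bounds. For a query object $O$, the predicate $\mathrm{Incircle}(S_1,S_2,S_3,O)$ has the value $-1$ if $O$ meets the interior of $D$, the value $0$ if $O$ meets the boundary but not the interior of $D$, and the value $+1$ if $O$ does not meet $D$. **Theorem.** For each choice of the types (point or segment) of $S_1,S_2,S_3,O$ there is a finite decision tree, each inner node of which branches on the sign (negative, zero, positive) of a polynomial with integer coefficients of total degree at most $6$ in the coordinates of $S_1,S_2,S_3,O$, and which computes $\mathrm{Incircle}(S_1,S_2,S_3,O)$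 for all inputs of these types for which $V(S_1,S_2,S_3)$ exists. More precisely, the bound $6$ on the degrees can be replaced by the following bounds, which depend on the type of $O$ and on how many of $S_1,S_2,S_3$ are segments, where $P$ stands for a point and $S$ for a segment (the sites may be given in any order): | | $PPP$ | $PPS$ | $PSS$ | $SSS$ | |---|---|---|---|---| | $O$ is a point | 4 | 6 | 4 | 2 | | $O$ is a segment | 6 | 6 | 4 | 2 | -/

import Mathlib

/-- The Euclidean plane; `p 0` and `p 1` are the `x`- and the `y`-coordinate of `p`. -/
abbrev EPlane : Type := EuclideanSpace ℝ (Fin 2)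

/-- The two types of sites. -/
inductive SiteKind : Type
  | point
  | segment

/-- A site, as it is given in the input: a point, or an open segment described by its two
endpoints. -/
inductive VSite : Type
  | point (A : EPlane)
  | segment (C D : EPlane)

namespace VSite

/-- The type (point or segment) of a site. -/
def kind : VSite → SiteKind
  | point _ => SiteKind.point
  | segment _ _ => SiteKind.segment

/-- A segment is non-degenerate and parallel to one of the two coordinate axes; there is no
condition on points. -/
def AxesAligned : VSite → Prop
  | point _ => True
  | segment C D => C ≠ D ∧ (C 0 = D 0 ∨ C 1 = D 1)

/-- The point set of a site; segments are open. -/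
def carrier : VSite → Set EPlane
  | point A => {A}
  | segment C D => openSegment ℝ C D

/-- The input coordinates of a site: `S.coord e j` is the `j`-th coordinate of the `e`-th
endpoint. A point has a single pair of coordinates, which is repeated. -/
def coord : VSite → Fin 2 → Fin 2 → ℝ
  | point A => fun _ j => A j
  | segment C D => fun e j => if e = 0 then C j else D j

/-- The circle with centre `K` and radius `ρ` touches the site at `p`: it goes through a point
site, and it is tangent to (the closure of) a segment site. The point of tangency may be an
endpoint of the segment. -/
def TouchedAt : VSite → EPlane → ℝ → EPlane → Prop
  | point A, K, ρ, p => p = A ∧ dist K p = ρ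
  | segment C D, K, ρ, p =>
      p ∈ _root_.segment ℝ C D ∧ dist K p = ρ ∧ inner ℝ (p - K) (D - C) = 0

/-- A point of the site: the point itself, respectively the midpoint of the segment. -/
noncomputable def rep : VSite → EPlane
  | point A => A
  | segment C D => midpoint ℝ C D

end VSite

/-- Twice the signed area of the triangle `p q r`; it is positive if and only if `p`, `q`, `r`
form a left turn. For points of a circle this means that they are distinct and that they are met
in this cyclic order when the circle is traversed counterclockwise. -/
def orient (p q r : EPlane) : ℝ :=
  (q 0 - p 0) * (r 1 - p 1) - (q 1 - p 1) * (r 0 - p 0)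

/-- The sites, touched by a circle at `p₁`, `p₂`, `p₃`, are discovered in the cyclic order
`S₁`, `S₂`, `S₃` in a counterclockwise traversal of the circle.
If exactly two of the points of contact coincide (an endpoint of a segment and the segment
itself, or two collinear segments with a common endpoint), then these two sites lie on the tangent
line of the circle at this point, and their mutual order is their order along this line, in the
direction of the traversal. If all three coincide, then no order is defined. -/
def DiscoveredCCW (S₁ S₂ S₃ : VSite) (p₁ p₂ p₃ : EPlane) : Prop :=
  0 < orient p₁ p₂ p₃ ∨
  (p₁ = p₂ ∧ 0 < orient S₁.rep S₂.rep p₃) ∨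
  (p₂ = p₃ ∧ 0 < orient p₁ S₂.rep S₃.rep) ∨
  (p₃ = p₁ ∧ 0 < orient S₁.rep p₂ S₃.rep)

/-- The circle with centre `K` and radius `ρ` is the Voronoi circle `V(S₁, S₂, S₃)`. -/
def IsVoronoiCircle (S₁ S₂ S₃ : VSite) (K : EPlane) (ρ : ℝ) : Prop :=
  0 < ρ ∧ ∃ p₁ p₂ p₃ : EPlane,
    S₁.TouchedAt K ρ p₁ ∧ S₂.TouchedAt K ρ p₂ ∧ S₃.TouchedAt K ρ p₃ ∧
    DiscoveredCCW S₁ S₂ S₃ p₁ p₂ p₃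

open Classical in
/-- The value of the Incircle predicate for the query object `O` and the disk with centre `K` and
radius `ρ`: negative if `O` meets the interior of the disk, zero if it meets the boundary but not
the interior, and positive if it does not meet the disk. -/
noncomputable def incircleValue (K : EPlane) (ρ : ℝ) (O : VSite) : SignType :=
  if (O.carrier ∩ Metric.ball K ρ).Nonempty then -1
  else if (O.carrier ∩ Metric.sphere K ρ).Nonempty then 0
  else 1

/-- A decision procedure that evaluates signs of polynomials with integer coefficients: a finite
tree that at each inner node branches on the sign of a polynomial in the variables `σ`, and that
answers with the label of the leaf that is reached. -/
inductive SignTree (σ : Type) : Type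
  | leaf (answer : SignType)
  | node (p : MvPolynomial σ ℤ) (ifNeg ifZero ifPos : SignTree σ)

namespace SignTree

/-- The answer for the input `x`. -/
noncomputable def eval {σ : Type} (x : σ → ℝ) : SignTree σ → SignType
  | leaf s => s
  | node p ifNeg ifZero ifPos =>
      match SignType.sign (MvPolynomial.aeval x p : ℝ) with
      | SignType.neg => eval x ifNeg
      | SignType.zero => eval x ifZero
      | SignType.pos => eval x ifPos

/-- All polynomials in the tree have total degree at most `d`. -/
def DegreeLE {σ : Type} (d : ℕ) : SignTree σ → Prop
  | leaf _ => True
  | node p ifNeg ifZero ifPos =>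
      p.totalDegree ≤ d ∧ ifNeg.DegreeLE d ∧ ifZero.DegreeLE d ∧ ifPos.DegreeLE d

end SignTree

/-- The input of the predicate: all coordinates of the three sites and of the query object. The
first index selects the object, the second the endpoint, and the third the coordinate. -/
def inputCoords (S₁ S₂ S₃ O : VSite) : Fin 4 × Fin 2 × Fin 2 → ℝ :=
  fun v => (![S₁, S₂, S₃, O] v.1).coord v.2.1 v.2.2

/-- For sites of types `k₁`, `k₂`, `k₃` and a query object of type `kO`, the Incircle predicate
can be decided from signs of polynomials of degree at most `d` in the input coordinates, by one
procedure for all inputs of these types for which the Voronoi circle exists. -/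
def IncircleDecidableInDegree (k₁ k₂ k₃ kO : SiteKind) (d : ℕ) : Prop :=
  ∃ t : SignTree (Fin 4 × Fin 2 × Fin 2), t.DegreeLE d ∧
    ∀ S₁ S₂ S₃ O : VSite,
      S₁.kind = k₁ → S₂.kind = k₂ → S₃.kind = k₃ → O.kind = kO →
      S₁.AxesAligned → S₂.AxesAligned → S₃.AxesAligned → O.AxesAligned →
      Disjoint S₁.carrier S₂.carrier → Disjoint S₂.carrier S₃.carrier →
      Disjoint S₁.carrier S₃.carrier →
      ∀ (K : EPlane) (ρ : ℝ), IsVoronoiCircle S₁ S₂ S₃ K ρ →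
        t.eval (inputCoords S₁ S₂ S₃ O) = incircleValue K ρ O

/-- `1` for a segment and `0` for a point. -/
def SiteKind.segCount : SiteKind → ℕ
  | point => 0
  | segment => 1

/-- The table of degrees: the first argument is the type of the query object, the second the
number of segments among the three sites (that is, `PPP`, `PPS`, `PSS`, `SSS`). -/
def incircleDegree : SiteKind → ℕ → ℕ
  | SiteKind.point, 0 => 4
  | SiteKind.point, 1 => 6
  | SiteKind.point, 2 => 4
  | SiteKind.point, _ => 2
  | SiteKind.segment, 0 => 6
  | SiteKind.segment, 1 => 6
  | SiteKind.segment, 2 => 4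
  | SiteKind.segment, _ => 2

/-!
The predicate depends on the centre `K = (u, v)` and the radius `ρ` of the Voronoi circle only
through the signs of `(q₁ - u) ^ 2 + (q₂ - v) ^ 2 - ρ ^ 2`, where `q` is a query point or an endpoint
of a query segment, and of `u - c`, `v - c`, `(u - c) ^ 2 - ρ ^ 2`, `(v - c) ^ 2 - ρ ^ 2`, where `c` is
a coordinate of a query segment (`VSite.Along.incircleValue_eq`). In particular only the square of
the radius matters, so `ρ` may be replaced by a signed distance of the centre from a segment.

In each configuration of the sites there is a denominator `m` such that `m * u`, `m * v` and `m * ρ`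
have the form `P + Q * w` with polynomials `P`, `Q` and a square root `w ≥ 0` of a polynomial `D`.
(For three points this is the case for the centre only.) The square root is the orientation of the
three points of contact, up to a factor of known sign; the cyclic order of the sites thus selects
the circle among the two that touch them. If two points of contact coincide, then the orientation
vanishes and either `w = 0`, so that the same formulas hold, or the circle is rational; the order of
the two sites along their common line tells on which side of this line the centre lies. The sign of
`P + Q * w` follows from the signs of `P`, `Q` and `P ^ 2 - Q ^ 2 * D`
(`SignDec.sign_add_mul`). Counting degrees gives all the bounds (`CircleDec.of_quadratic`,
`CircleDec.of_rational`, `CircleDec.of_three_points`) except for query points against a circle that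
passes through two points and is tangent to a segment: there `P ^ 2 - Q ^ 2 * D` has degree 8, but
it is the product of the square of a linear form and of a polynomial of degree 6
(`CircleDec.of_two_points_tangent_of_ne`).

A tree that may start with tests on the coordinates, like the directions of the segments, amounts to
a case distinction in a proof (`SignDec.bind`), and a function that is a polynomial of low degree in
linear functions of the input is one in the input itself (`PolyFn`). So the configurations are
treated for arbitrary families of inputs, with one of the coordinate axes moved to the segment by an
integer linear substitution.
-/

/-! ### Functions computed by sign trees -/

namespace SignTree

variable {σ : Type}

/-- Replace every leaf of a tree by the tree that `k` assigns to its label. -/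
def graft (k : SignType → SignTree σ) : SignTree σ → SignTree σ
  | leaf s => k s
  | node p a b c => node p (a.graft k) (b.graft k) (c.graft k)

theorem eval_graft (x : σ → ℝ) (k : SignType → SignTree σ) (t : SignTree σ) :
    (t.graft k).eval x = (k (t.eval x)).eval x := by
  induction t with
  | leaf s => rfl
  | node p a b c ha hb hc =>
    simp only [graft, eval]
    cases SignType.sign (MvPolynomial.aeval x p : ℝ) <;> assumption

theorem DegreeLE.graft {d : ℕ} {k : SignType → SignTree σ} {t : SignTree σ}
    (ht : t.DegreeLE d) (hk : ∀ s, (k s).DegreeLE d) : (t.graft k).DegreeLE d := by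
  induction t with
  | leaf s => exact hk s
  | node p a b c ha hb hc => exact ⟨ht.1, ha ht.2.1, hb ht.2.2.1, hc ht.2.2.2⟩

theorem DegreeLE.mono {d e : ℕ} (hde : d ≤ e) {t : SignTree σ} (ht : t.DegreeLE d) :
    t.DegreeLE e := by
  induction t with
  | leaf s => trivial
  | node p a b c ha hb hc =>
    exact ⟨ht.1.trans hde, ha ht.2.1, hb ht.2.2.1, hc ht.2.2.2⟩

end SignTree

/-- The real function `f` on a family `X` of inputs with coordinates `x` is an integer polynomial
of total degree at most `n` in these coordinates. -/
def PolyFn {X σ : Type} (x : X → σ → ℝ) (n : ℕ) (f : X → ℝ) : Prop :=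
  ∃ p : MvPolynomial σ ℤ, p.totalDegree ≤ n ∧ ∀ s, (MvPolynomial.aeval (x s) p : ℝ) = f s

/-- On the inputs that satisfy `dom`, the function `g` is computed by a single sign tree with
polynomials of degree at most `d` in the coordinates `x`. -/
def SignDec {X σ : Type} (x : X → σ → ℝ) (d : ℕ) (dom : X → Prop) (g : X → SignType) : Prop :=
  ∃ t : SignTree σ, t.DegreeLE d ∧ ∀ s, dom s → t.eval (x s) = g s

section Framework

variable {X σ : Type} {x : X → σ → ℝ} {m n d e : ℕ} {dom : X → Prop} {f g : X → ℝ}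

namespace PolyFn

theorem mono (h : PolyFn x m f) (hmn : m ≤ n) : PolyFn x n f := by
  obtain ⟨p, hp, hf⟩ := h
  exact ⟨p, hp.trans hmn, hf⟩

theorem var (i : σ) : PolyFn x 1 (fun s => x s i) :=
  ⟨MvPolynomial.X i, (MvPolynomial.totalDegree_X (R := ℤ) i).le, fun s => by simp⟩

theorem intCast (c : ℤ) : PolyFn x n (fun _ => (c : ℝ)) :=
  ⟨MvPolynomial.C c, by rw [MvPolynomial.totalDegree_C]; exact n.zero_le, fun s => by simp⟩

theorem zero : PolyFn x n (fun _ => 0) := by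
  simpa using intCast (x := x) (n := n) 0

theorem one : PolyFn x n (fun _ => 1) := by
  simpa using intCast (x := x) (n := n) 1

theorem ofNat (c : ℕ) [c.AtLeastTwo] : PolyFn x n (fun _ => (OfNat.ofNat c : ℝ)) := by
  simpa using intCast (x := x) (n := n) (OfNat.ofNat c)

theorem add (hf : PolyFn x n f) (hg : PolyFn x n g) : PolyFn x n (fun s => f s + g s) := by
  obtain ⟨p, hp, hf⟩ := hf
  obtain ⟨q, hq, hg⟩ := hg
  exact ⟨p + q, (MvPolynomial.totalDegree_add p q).trans (max_le hp hq),
    fun s => by rw [map_add, hf, hg]⟩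

theorem neg (hf : PolyFn x n f) : PolyFn x n (fun s => -f s) := by
  obtain ⟨p, hp, hf⟩ := hf
  exact ⟨-p, by rwa [MvPolynomial.totalDegree_neg], fun s => by rw [map_neg, hf]⟩

theorem sub (hf : PolyFn x n f) (hg : PolyFn x n g) : PolyFn x n (fun s => f s - g s) := by
  simpa only [sub_eq_add_neg] using hf.add hg.neg

theorem mul (hf : PolyFn x m f) (hg : PolyFn x n g) :
    PolyFn x (m + n) (fun s => f s * g s) := by
  obtain ⟨p, hp, hf⟩ := hf
  obtain ⟨q, hq, hg⟩ := hg
  exact ⟨p * q, (MvPolynomial.totalDegree_mul p q).trans (Nat.add_le_add hp hq),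
    fun s => by rw [map_mul, hf, hg]⟩

theorem sq (hf : PolyFn x n f) : PolyFn x (n + n) (fun s => f s ^ 2) := by
  simpa only [pow_two] using hf.mul hf

theorem intCast_mul (c : ℤ) (hf : PolyFn x n f) : PolyFn x n (fun s => (c : ℝ) * f s) := by
  simpa using (intCast (n := 0) c).mul hf

theorem ofNat_mul (c : ℕ) [c.AtLeastTwo] (hf : PolyFn x n f) :
    PolyFn x n (fun s => (OfNat.ofNat c : ℝ) * f s) := by
  simpa using (ofNat (n := 0) c).mul hf

theorem signDec (hf : PolyFn x n f) (hn : n ≤ d) :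
    SignDec x d dom (fun s => SignType.sign (f s)) := by
  obtain ⟨p, hp, hf⟩ := hf
  refine ⟨.node p (.leaf .neg) (.leaf .zero) (.leaf .pos),
    ⟨hp.trans hn, trivial, trivial, trivial⟩, fun s _ => ?_⟩
  simp only [SignTree.eval, ← hf s]
  cases SignType.sign (MvPolynomial.aeval (x s) p : ℝ) <;> rfl

end PolyFn

namespace SignDec

variable {F G : X → SignType}

theorem congr (h : SignDec x d dom F) (hFG : ∀ s, dom s → F s = G s) : SignDec x d dom G := by
  obtain ⟨t, ht, h⟩ := h
  exact ⟨t, ht, fun s hs => (h s hs).trans (hFG s hs)⟩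

theorem mono (h : SignDec x d dom F) (hde : d ≤ e) : SignDec x e dom F := by
  obtain ⟨t, ht, h⟩ := h
  exact ⟨t, ht.mono hde, h⟩

theorem const (c : SignType) : SignDec x d dom (fun _ => c) :=
  ⟨.leaf c, trivial, fun _ _ => rfl⟩

/-- Case distinction on a computable sign. -/
theorem bind (hF : SignDec x d dom F)
    (hG : ∀ c, SignDec x d (fun s => dom s ∧ F s = c) G) : SignDec x d dom G := by
  obtain ⟨t, ht, hF⟩ := hF
  choose k hk hG using hG
  refine ⟨t.graft k, ht.graft hk, fun s hs => ?_⟩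
  rw [SignTree.eval_graft, hF s hs]
  exact hG _ s ⟨hs, rfl⟩

theorem restrict {dom' : X → Prop} (hF : SignDec x d dom F) (h : ∀ s, dom' s → dom s) :
    SignDec x d dom' F := by
  obtain ⟨t, ht, hF⟩ := hF
  exact ⟨t, ht, fun s hs => hF s (h s hs)⟩

theorem map (φ : SignType → SignType) (hF : SignDec x d dom F) :
    SignDec x d dom (fun s => φ (F s)) :=
  hF.bind fun c => (const (φ c)).congr fun _ hs => by rw [hs.2]

theorem map₂ (φ : SignType → SignType → SignType) (hF : SignDec x d dom F)
    (hG : SignDec x d dom G) : SignDec x d dom (fun s => φ (F s) (G s)) :=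
  hF.bind fun c => ((hG.restrict fun _ hs => hs.1).map (φ c)).congr fun _ hs => by rw [hs.2]

theorem sign_mul (hf : SignDec x d dom (fun s => SignType.sign (f s)))
    (hg : SignDec x d dom (fun s => SignType.sign (g s))) :
    SignDec x d dom (fun s => SignType.sign (f s * g s)) :=
  (map₂ (· * ·) hf hg).congr fun _ _ => (_root_.sign_mul _ _).symm

/-- Case distinction on the sign of a polynomial. -/
theorem split {H : X → SignType} (hf : PolyFn x n f) (hn : n ≤ d)
    (hneg : SignDec x d (fun s => dom s ∧ f s < 0) H)
    (hzero : SignDec x d (fun s => dom s ∧ f s = 0) H)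
    (hpos : SignDec x d (fun s => dom s ∧ 0 < f s) H) : SignDec x d dom H := by
  refine (hf.signDec hn).bind fun c => ?_
  cases c
  · exact hzero.restrict fun s hs => ⟨hs.1, sign_eq_zero_iff.1 hs.2⟩
  · exact hneg.restrict fun s hs => ⟨hs.1, sign_eq_neg_one_iff.1 hs.2⟩
  · exact hpos.restrict fun s hs => ⟨hs.1, sign_eq_one_iff.1 hs.2⟩

theorem sign_of_mul {c : X → ℝ} (hc : SignDec x d dom (fun s => SignType.sign (c s)))
    (hc0 : ∀ s, dom s → c s ≠ 0) (hf : SignDec x d dom (fun s => SignType.sign (c s * f s))) :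
    SignDec x d dom (fun s => SignType.sign (f s)) := by
  refine (map₂ (· * ·) hc hf).congr fun s hs => ?_
  rw [_root_.sign_mul]
  rcases lt_or_gt_of_ne (hc0 s hs) with h | h
  · simp [sign_neg h]
  · simp [sign_pos h]

end SignDec

/-- The sign of `P + Q * w`, for `w ≥ 0`, in terms of the signs of `P`, `Q` and
`P ^ 2 - Q ^ 2 * w ^ 2`. -/
def signAddSqrt : SignType → SignType → SignType → SignType
  | .zero, .zero, _ => .zero
  | .zero, .pos, r => -r
  | .zero, .neg, r => r
  | .pos, .neg, r => r
  | .pos, _, _ => .pos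
  | .neg, .pos, r => -r
  | .neg, _, _ => .neg

theorem sign_add_mul_eq (P Q w : ℝ) (hw : 0 ≤ w) :
    signAddSqrt (SignType.sign P) (SignType.sign Q) (SignType.sign (P ^ 2 - Q ^ 2 * w ^ 2)) =
      SignType.sign (P + Q * w) := by
  have key : P ^ 2 - Q ^ 2 * w ^ 2 = (P - Q * w) * (P + Q * w) := by ring
  rcases lt_trichotomy P 0 with hP | hP | hP <;> rcases lt_trichotomy Q 0 with hQ | hQ | hQ
  · have h : P + Q * w < 0 := by nlinarith [mul_nonneg (neg_pos.2 hQ).le hw]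
    rw [sign_neg hP, sign_neg hQ, sign_neg h]
    rfl
  · have h : P + Q * w < 0 := by rw [hQ]; linarith
    rw [sign_neg hP, sign_neg h, hQ, sign_zero]
    rfl
  · have h : P - Q * w < 0 := by nlinarith [mul_nonneg hQ.le hw]
    rw [sign_neg hP, sign_pos hQ, key, sign_mul, sign_neg h]
    change -(-1 * SignType.sign (P + Q * w)) = _
    simp
  · subst hP
    rw [sign_zero, sign_neg hQ]
    change SignType.sign (0 ^ 2 - Q ^ 2 * w ^ 2) = _
    rcases hw.eq_or_lt with rfl | hw
    · simp
    · have h₁ : 0 + Q * w < 0 := by nlinarith [mul_pos (neg_pos.2 hQ) hw]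
      have h₂ : 0 ^ 2 - Q ^ 2 * w ^ 2 < 0 := by nlinarith
      rw [sign_neg h₁, sign_neg h₂]
  · subst hP hQ
    simp [signAddSqrt]
  · subst hP
    rw [sign_zero, sign_pos hQ]
    change -SignType.sign (0 ^ 2 - Q ^ 2 * w ^ 2) = _
    rcases hw.eq_or_lt with rfl | hw
    · simp
    · have h₁ : 0 < 0 + Q * w := by nlinarith [mul_pos hQ hw]
      have h₂ : 0 ^ 2 - Q ^ 2 * w ^ 2 < 0 := by nlinarith
      rw [sign_pos h₁, sign_neg h₂]
      rfl
  · have h : 0 < P - Q * w := by nlinarith [mul_nonneg (neg_pos.2 hQ).le hw]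
    rw [sign_pos hP, sign_neg hQ, key, sign_mul, sign_pos h]
    change 1 * SignType.sign (P + Q * w) = _
    simp
  · have h : 0 < P + Q * w := by rw [hQ]; linarith
    rw [sign_pos hP, sign_pos h, hQ, sign_zero]
    rfl
  · have h : 0 < P + Q * w := by nlinarith [mul_nonneg hQ.le hw]
    rw [sign_pos hP, sign_pos hQ, sign_pos h]
    rfl

/-- The sign of `P + Q * w` with `w ≥ 0`, when a polynomial `R` has the sign of
`P ^ 2 - Q ^ 2 * w ^ 2`. Letting `R` be a proper factor of the latter lowers the degree. -/
theorem SignDec.sign_add_mul {P Q R w : X → ℝ} {p q r : ℕ} (hP : PolyFn x p P)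
    (hQ : PolyFn x q Q) (hR : PolyFn x r R) (hp : p ≤ d) (hq : q ≤ d) (hr : r ≤ d)
    (hw : ∀ s, dom s → 0 ≤ w s)
    (hsign : ∀ s, dom s →
      SignType.sign (R s) = SignType.sign (P s ^ 2 - Q s ^ 2 * w s ^ 2)) :
    SignDec x d dom (fun s => SignType.sign (P s + Q s * w s)) := by
  have h₁ : SignDec x d dom (fun s => SignType.sign (P s)) := hP.signDec hp
  have h₂ : SignDec x d dom (fun s => SignType.sign (Q s)) := hQ.signDec hq
  have h₃ : SignDec x d dom (fun s => SignType.sign (R s)) := hR.signDec hr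
  refine h₁.bind fun c₁ => (h₂.restrict fun _ hs => hs.1).bind fun c₂ =>
    ((h₃.restrict fun _ hs => hs.1.1).map (signAddSqrt c₁ c₂)).congr fun s hs => ?_
  rw [← hs.1.2, ← hs.2, hsign s hs.1.1, sign_add_mul_eq _ _ _ (hw s hs.1.1)]

end Framework

/-! ### Queries against a circle -/

section Circle

variable {X σ : Type} {x : X → σ → ℝ} {d e : ℕ} {dom : X → Prop} {u v ρ : X → ℝ}

/-- For the circles with centre `(u, v)` and radius `ρ`, the position of every query point whose
coordinates are linear in the input can be decided in degree `d`. -/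
def PointDec (x : X → σ → ℝ) (d : ℕ) (dom : X → Prop) (u v ρ : X → ℝ) : Prop :=
  ∀ q₁ q₂ : X → ℝ, PolyFn x 1 q₁ → PolyFn x 1 q₂ →
    SignDec x d dom (fun s => SignType.sign ((q₁ s - u s) ^ 2 + (q₂ s - v s) ^ 2 - ρ s ^ 2))

/-- For the circles with centre `(u, v)` and radius `ρ`, the positions of the centre and of the
circle relative to every axis-parallel line whose offset is linear in the input can be decided in
degree `d`. -/
structure LineDec (x : X → σ → ℝ) (d : ℕ) (dom : X → Prop) (u v ρ : X → ℝ) : Prop where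
  fstCoord : ∀ c, PolyFn x 1 c → SignDec x d dom (fun s => SignType.sign (u s - c s))
  sndCoord : ∀ c, PolyFn x 1 c → SignDec x d dom (fun s => SignType.sign (v s - c s))
  fstLine : ∀ c, PolyFn x 1 c →
    SignDec x d dom (fun s => SignType.sign ((u s - c s) ^ 2 - ρ s ^ 2))
  sndLine : ∀ c, PolyFn x 1 c →
    SignDec x d dom (fun s => SignType.sign ((v s - c s) ^ 2 - ρ s ^ 2))

/-- Point queries can be decided in degree `d`, and line queries in degree `e`. -/
structure CircleDec (x : X → σ → ℝ) (d e : ℕ) (dom : X → Prop) (u v ρ : X → ℝ) : Prop where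
  point : PointDec x d dom u v ρ
  line : LineDec x e dom u v ρ

namespace CircleDec

theorem mono {d' e' : ℕ} (h : CircleDec x d e dom u v ρ) (hd : d ≤ d') (he : e ≤ e') :
    CircleDec x d' e' dom u v ρ where
  point q₁ q₂ h₁ h₂ := (h.point q₁ q₂ h₁ h₂).mono hd
  line :=
    { fstCoord := fun c hc => (h.line.fstCoord c hc).mono he
      sndCoord := fun c hc => (h.line.sndCoord c hc).mono he
      fstLine := fun c hc => (h.line.fstLine c hc).mono he
      sndLine := fun c hc => (h.line.sndLine c hc).mono he }

theorem restrict {dom' : X → Prop} (h : CircleDec x d e dom u v ρ)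
    (hdom : ∀ s, dom' s → dom s) : CircleDec x d e dom' u v ρ where
  point q₁ q₂ h₁ h₂ := (h.point q₁ q₂ h₁ h₂).restrict hdom
  line :=
    { fstCoord := fun c hc => (h.line.fstCoord c hc).restrict hdom
      sndCoord := fun c hc => (h.line.sndCoord c hc).restrict hdom
      fstLine := fun c hc => (h.line.fstLine c hc).restrict hdom
      sndLine := fun c hc => (h.line.sndLine c hc).restrict hdom }

theorem swap (h : CircleDec x d e dom u v ρ) : CircleDec x d e dom v u ρ where
  point q₁ q₂ h₁ h₂ := (h.point q₂ q₁ h₂ h₁).congr fun s _ => by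
    rw [add_comm ((q₂ s - u s) ^ 2)]
  line :=
    { fstCoord := h.line.sndCoord
      sndCoord := h.line.fstCoord
      fstLine := h.line.sndLine
      sndLine := h.line.fstLine }

theorem translate {a b : X → ℝ} (ha : PolyFn x 1 a) (hb : PolyFn x 1 b)
    (h : CircleDec x d e dom (fun s => u s - a s) (fun s => v s - b s) ρ) :
    CircleDec x d e dom u v ρ where
  point _ _ h₁ h₂ := by
    simpa only [sub_sub_sub_cancel_right] using h.point _ _ (h₁.sub ha) (h₂.sub hb)
  line :=
    { fstCoord := fun c hc => by
        simpa only [sub_sub_sub_cancel_right] using h.line.fstCoord _ (hc.sub ha)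
      sndCoord := fun c hc => by
        simpa only [sub_sub_sub_cancel_right] using h.line.sndCoord _ (hc.sub hb)
      fstLine := fun c hc => by
        simpa only [sub_sub_sub_cancel_right] using h.line.fstLine _ (hc.sub ha)
      sndLine := fun c hc => by
        simpa only [sub_sub_sub_cancel_right] using h.line.sndLine _ (hc.sub hb) }

/-- Only the square of the radius matters, so a signed radius may be used instead. -/
theorem congr_radius {r : X → ℝ} (h : CircleDec x d e dom u v r)
    (hr : ∀ s, dom s → r s ^ 2 = ρ s ^ 2) : CircleDec x d e dom u v ρ where
  point _ _ h₁ h₂ := (h.point _ _ h₁ h₂).congr fun s hs => by rw [hr s hs]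
  line :=
    { fstCoord := h.line.fstCoord
      sndCoord := h.line.sndCoord
      fstLine := fun c hc => (h.line.fstLine c hc).congr fun s hs => by rw [hr s hs]
      sndLine := fun c hc => (h.line.sndLine c hc).congr fun s hs => by rw [hr s hs] }

theorem split {f : X → ℝ} (hf : PolyFn x 1 f) (hd : 1 ≤ d) (he : 1 ≤ e)
    (hneg : CircleDec x d e (fun s => dom s ∧ f s < 0) u v ρ)
    (hzero : CircleDec x d e (fun s => dom s ∧ f s = 0) u v ρ)
    (hpos : CircleDec x d e (fun s => dom s ∧ 0 < f s) u v ρ) : CircleDec x d e dom u v ρ where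
  point _ _ h₁ h₂ := .split hf hd (hneg.point _ _ h₁ h₂) (hzero.point _ _ h₁ h₂)
    (hpos.point _ _ h₁ h₂)
  line :=
    { fstCoord := fun c hc => .split hf he (hneg.line.fstCoord c hc) (hzero.line.fstCoord c hc)
        (hpos.line.fstCoord c hc)
      sndCoord := fun c hc => .split hf he (hneg.line.sndCoord c hc) (hzero.line.sndCoord c hc)
        (hpos.line.sndCoord c hc)
      fstLine := fun c hc => .split hf he (hneg.line.fstLine c hc) (hzero.line.fstLine c hc)
        (hpos.line.fstLine c hc)
      sndLine := fun c hc => .split hf he (hneg.line.sndLine c hc) (hzero.line.sndLine c hc)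
        (hpos.line.sndLine c hc) }

theorem split_eq {f : X → ℝ} (hf : PolyFn x 1 f) (hd : 1 ≤ d) (he : 1 ≤ e)
    (hzero : CircleDec x d e (fun s => dom s ∧ f s = 0) u v ρ)
    (hne : CircleDec x d e (fun s => dom s ∧ f s ≠ 0) u v ρ) : CircleDec x d e dom u v ρ :=
  .split hf hd he (hne.restrict fun _ hs => ⟨hs.1, hs.2.ne⟩) hzero
    (hne.restrict fun _ hs => ⟨hs.1, hs.2.ne'⟩)

end CircleDec

/-- A class `L` of functions of decidable sign, closed under addition and subtraction, decides all
line queries for a circle whose centre and signed radius belong to it: the equation of a line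
tangent to the circle factors. -/
theorem LineDec.of_linear (L : (X → ℝ) → Prop) {r : X → ℝ}
    (hL : ∀ f, L f → SignDec x d dom (fun s => SignType.sign (f s)))
    (hc : ∀ c, PolyFn x 1 c → L c) (hadd : ∀ f g, L f → L g → L (fun s => f s + g s))
    (hsub : ∀ f g, L f → L g → L (fun s => f s - g s)) (hu : L u) (hv : L v) (hr : L r) :
    LineDec x d dom u v r := by
  have key : ∀ y, L y → ∀ c, PolyFn x 1 c →
      SignDec x d dom (fun s => SignType.sign ((y s - c s) ^ 2 - r s ^ 2)) := fun y hy c h => by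
    have h₀ := hsub y c hy (hc c h)
    simpa only [sq_sub_sq] using (hL _ (hadd _ _ h₀ hr)).sign_mul (hL _ (hsub _ _ h₀ hr))
  exact ⟨fun c h => hL _ (hsub u c hu (hc c h)), fun c h => hL _ (hsub v c hv (hc c h)),
    key u hu, key v hv⟩

/-- The function `y` is a quotient `P / m` with a numerator of degree at most `k + 1`. -/
def RatRep (x : X → σ → ℝ) (k : ℕ) (dom : X → Prop) (m y : X → ℝ) : Prop :=
  ∃ P, PolyFn x (k + 1) P ∧ ∀ s, dom s → m s * y s = P s

/-- The function `y` is a quotient `(P + Q * w) / m` with `P` of degree at most `k + 1` and `Q` of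
degree at most `j`; here `w` stands for the square root of a polynomial. -/
def QuadRep (x : X → σ → ℝ) (k j : ℕ) (dom : X → Prop) (m w y : X → ℝ) : Prop :=
  ∃ P Q, PolyFn x (k + 1) P ∧ PolyFn x j Q ∧ ∀ s, dom s → m s * y s = P s + Q s * w s

/-- A circle whose centre and signed radius are rational. -/
theorem CircleDec.of_rational {k : ℕ} {m r : X → ℝ} (hm : PolyFn x k m)
    (hm0 : ∀ s, dom s → m s ≠ 0) (hu : RatRep x k dom m u) (hv : RatRep x k dom m v)
    (hr : RatRep x k dom m r) : CircleDec x (2 * (k + 1)) (k + 1) dom u v r where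
  point q₁ q₂ h₁ h₂ := by
    obtain ⟨P, hP, hu⟩ := hu
    obtain ⟨Q, hQ, hv⟩ := hv
    obtain ⟨R, hR, hr⟩ := hr
    have h : PolyFn x (k + 1 + (k + 1)) (fun s =>
        (m s * q₁ s - P s) ^ 2 + (m s * q₂ s - Q s) ^ 2 - R s ^ 2) :=
      (((hm.mul h₁).sub hP).sq.add ((hm.mul h₂).sub hQ).sq).sub hR.sq
    refine SignDec.sign_of_mul (hm.mul hm |>.signDec (by omega))
      (fun s hs => mul_self_ne_zero.2 (hm0 s hs))
      ((h.signDec (by omega)).congr fun s hs => ?_)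
    congr 1
    rw [← hu s hs, ← hv s hs, ← hr s hs]
    ring
  line := by
    refine LineDec.of_linear (RatRep x k dom m) ?_ ?_ ?_ ?_ hu hv hr
    · rintro f ⟨P, hP, h⟩
      exact SignDec.sign_of_mul (hm.signDec (by omega)) hm0
        ((hP.signDec le_rfl).congr fun s hs => by rw [h s hs])
    · exact fun c hc => ⟨_, hm.mul hc, fun s _ => rfl⟩
    · rintro f g ⟨P, hP, hf⟩ ⟨Q, hQ, hg⟩
      exact ⟨_, hP.add hQ, fun s hs => by rw [mul_add, hf s hs, hg s hs]⟩
    · rintro f g ⟨P, hP, hf⟩ ⟨Q, hQ, hg⟩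
      exact ⟨_, hP.sub hQ, fun s hs => by rw [mul_sub, hf s hs, hg s hs]⟩

section Quadratic

variable {k j δ : ℕ} {m r w D : X → ℝ}

/-- Line queries for a circle whose centre and signed radius are quadratic irrationalities. -/
theorem LineDec.of_quadratic (hm : PolyFn x k m) (hm0 : ∀ s, dom s → m s ≠ 0)
    (hD : PolyFn x δ D) (hδ : 2 * j + δ = 2 * (k + 1)) (hw : ∀ s, dom s → 0 ≤ w s)
    (hwD : ∀ s, dom s → w s ^ 2 = D s) (hu : QuadRep x k j dom m w u)
    (hv : QuadRep x k j dom m w v) (hr : QuadRep x k j dom m w r) :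
    LineDec x (2 * (k + 1)) dom u v r := by
  refine LineDec.of_linear (QuadRep x k j dom m w) ?_ ?_ ?_ ?_ hu hv hr
  · rintro f ⟨P, Q, hP, hQ, h⟩
    have hR : PolyFn x (2 * (k + 1)) (fun s => P s ^ 2 - Q s ^ 2 * D s) :=
      (hP.sq.mono (by omega)).sub ((hQ.sq.mul hD).mono (by omega))
    exact SignDec.sign_of_mul (hm.signDec (by omega)) hm0
      ((SignDec.sign_add_mul hP hQ hR (by omega) (by omega) le_rfl hw
        fun s hs => by rw [hwD s hs]).congr fun s hs => by rw [h s hs])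
  · exact fun c hc => ⟨_, _, hm.mul hc, PolyFn.zero, fun s _ => by ring⟩
  · rintro f g ⟨P, Q, hP, hQ, hf⟩ ⟨P', Q', hP', hQ', hg⟩
    exact ⟨_, _, hP.add hP', hQ.add hQ', fun s hs => by rw [mul_add, hf s hs, hg s hs]; ring⟩
  · rintro f g ⟨P, Q, hP, hQ, hf⟩ ⟨P', Q', hP', hQ', hg⟩
    exact ⟨_, _, hP.sub hP', hQ.sub hQ', fun s hs => by rw [mul_sub, hf s hs, hg s hs]; ring⟩

/-- Point and line queries for a circle whose centre and signed radius are quadratic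
irrationalities. -/
theorem CircleDec.of_quadratic (hm : PolyFn x k m) (hm0 : ∀ s, dom s → m s ≠ 0)
    (hD : PolyFn x δ D) (hδ : 2 * j + δ = 2 * (k + 1)) (hw : ∀ s, dom s → 0 ≤ w s)
    (hwD : ∀ s, dom s → w s ^ 2 = D s) (hu : QuadRep x k j dom m w u)
    (hv : QuadRep x k j dom m w v) (hr : QuadRep x k j dom m w r) :
    CircleDec x (4 * (k + 1)) (2 * (k + 1)) dom u v r where
  point q₁ q₂ h₁ h₂ := by
    obtain ⟨P₁, Q₁, hP₁, hQ₁, hu⟩ := hu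
    obtain ⟨P₂, Q₂, hP₂, hQ₂, hv⟩ := hv
    obtain ⟨P₃, Q₃, hP₃, hQ₃, hr⟩ := hr
    have hA₁ := (hm.mul h₁).sub hP₁
    have hA₂ := (hm.mul h₂).sub hP₂
    have hP := ((hA₁.sq.add hA₂.sq).sub hP₃.sq).add
      ((((hQ₁.sq.add hQ₂.sq).sub hQ₃.sq).mul hD).mono (n := k + 1 + (k + 1)) (by omega))
    have hQ := (((hA₁.mul hQ₁).add (hA₂.mul hQ₂)).add (hP₃.mul hQ₃)).intCast_mul (-2)
    have hR : PolyFn x (4 * (k + 1)) _ :=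
      (hP.sq.mono (by omega)).sub ((hQ.sq.mul hD).mono (by omega))
    refine SignDec.sign_of_mul (hm.mul hm |>.signDec (by omega))
      (fun s hs => mul_self_ne_zero.2 (hm0 s hs))
      ((SignDec.sign_add_mul hP hQ hR (by omega) (by omega) le_rfl hw
        fun s hs => by rw [hwD s hs]).congr fun s hs => ?_)
    congr 1
    push_cast
    linear_combination
      (2 * m s * q₁ s - m s * u s - P₁ s - Q₁ s * w s) * hu s hs
      + (2 * m s * q₂ s - m s * v s - P₂ s - Q₂ s * w s) * hv s hs
      + (m s * r s + P₃ s + Q₃ s * w s) * hr s hs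
      - (Q₁ s ^ 2 + Q₂ s ^ 2 - Q₃ s ^ 2) * hwD s hs
  line := .of_quadratic hm hm0 hD hδ hw hwD hu hv hr

end Quadratic

end Circle

/-! ### Circles given by contact conditions -/

section Families

variable {X σ : Type} {x : X → σ → ℝ} {d e : ℕ} {dom : X → Prop} {u v ρ : X → ℝ}

/-- Case distinction on the sign of `y = ±ρ`, which is the sign of `f`, or that of `g` where `f`
vanishes. -/
theorem CircleDec.split_sign {f g y : X → ℝ} (hf : PolyFn x 1 f) (hg : PolyFn x 1 g)
    (hd : 1 ≤ d) (he : 1 ≤ e) (hρ : ∀ s, dom s → 0 < ρ s) (hy : ∀ s, dom s → y s ^ 2 = ρ s ^ 2)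
    (hfg : ∀ s, dom s → 0 < f s * y s ∨ f s = 0 ∧ 0 < g s * y s)
    (h : ∀ ε : ℤ, ε ^ 2 = 1 → CircleDec x d e (fun s => dom s ∧ y s = ε * ρ s) u v ρ) :
    CircleDec x d e dom u v ρ := by
  have hneg : CircleDec x d e (fun s => dom s ∧ y s < 0) u v ρ :=
    (h (-1) (by norm_num)).restrict fun s hs => ⟨hs.1, by
      rcases sq_eq_sq_iff_eq_or_eq_neg.1 (hy s hs.1) with h | h
      · linarith [hρ s hs.1, hs.2]
      · push_cast; linarith⟩
  have hpos : CircleDec x d e (fun s => dom s ∧ 0 < y s) u v ρ :=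
    (h 1 (by norm_num)).restrict fun s hs => ⟨hs.1, by
      rcases sq_eq_sq_iff_eq_or_eq_neg.1 (hy s hs.1) with h | h
      · push_cast; linarith
      · linarith [hρ s hs.1, hs.2]⟩
  refine .split hf hd he ?_ (.split hg hd he ?_ ?_ ?_) ?_
  · refine hneg.restrict fun s hs => ⟨hs.1, ?_⟩
    rcases hfg s hs.1 with h | h
    · exact (neg_iff_neg_of_mul_pos h).1 hs.2
    · linarith [h.1, hs.2]
  · refine hneg.restrict fun s hs => ⟨hs.1.1, ?_⟩
    rcases hfg s hs.1.1 with h | h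
    · rw [hs.1.2, zero_mul] at h
      exact absurd h (lt_irrefl _)
    · by_contra hn
      nlinarith [hs.2, h.2, not_lt.1 hn]
  · refine hneg.restrict fun s hs => ?_
    exfalso
    rcases hfg s hs.1.1 with h | h
    · rw [hs.1.2, zero_mul] at h
      exact absurd h (lt_irrefl _)
    · rw [hs.2, zero_mul] at h
      exact absurd h.2 (lt_irrefl _)
  · refine hpos.restrict fun s hs => ⟨hs.1.1, ?_⟩
    rcases hfg s hs.1.1 with h | h
    · rw [hs.1.2, zero_mul] at h
      exact absurd h (lt_irrefl _)
    · exact (pos_iff_pos_of_mul_pos h.2).1 hs.2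
  · refine hpos.restrict fun s hs => ⟨hs.1, ?_⟩
    rcases hfg s hs.1 with h | h
    · exact (pos_iff_pos_of_mul_pos h).1 hs.2
    · linarith [h.1, hs.2]

/-- Circles through the origin and two further points that are not collinear with it. -/
theorem CircleDec.of_three_points {b₁ b₂ c₁ c₂ : X → ℝ} (hb₁ : PolyFn x 1 b₁)
    (hb₂ : PolyFn x 1 b₂) (hc₁ : PolyFn x 1 c₁) (hc₂ : PolyFn x 1 c₂)
    (hA : ∀ s, dom s → u s ^ 2 + v s ^ 2 = ρ s ^ 2)
    (hB : ∀ s, dom s → (b₁ s - u s) ^ 2 + (b₂ s - v s) ^ 2 = ρ s ^ 2)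
    (hC : ∀ s, dom s → (c₁ s - u s) ^ 2 + (c₂ s - v s) ^ 2 = ρ s ^ 2)
    (hne : ∀ s, dom s → b₁ s * c₂ s - b₂ s * c₁ s ≠ 0) :
    CircleDec x 4 6 dom u v ρ := by
  have hm := ((hb₁.mul hc₂).sub (hb₂.mul hc₁)).ofNat_mul 2
  have hm0 : ∀ s, dom s → 2 * (b₁ s * c₂ s - b₂ s * c₁ s) ≠ 0 := fun s hs =>
    mul_ne_zero two_ne_zero (hne s hs)
  have hU := ((hb₁.sq.add hb₂.sq).mul hc₂).sub ((hc₁.sq.add hc₂.sq).mul hb₂)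
  have hV := ((hc₁.sq.add hc₂.sq).mul hb₁).sub ((hb₁.sq.add hb₂.sq).mul hc₁)
  have hu : ∀ s, dom s → 2 * (b₁ s * c₂ s - b₂ s * c₁ s) * u s =
      (b₁ s ^ 2 + b₂ s ^ 2) * c₂ s - (c₁ s ^ 2 + c₂ s ^ 2) * b₂ s := fun s hs => by
    linear_combination c₂ s * (hA s hs - hB s hs) - b₂ s * (hA s hs - hC s hs)
  have hv : ∀ s, dom s → 2 * (b₁ s * c₂ s - b₂ s * c₁ s) * v s =
      (c₁ s ^ 2 + c₂ s ^ 2) * b₁ s - (b₁ s ^ 2 + b₂ s ^ 2) * c₁ s := fun s hs => by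
    linear_combination b₁ s * (hA s hs - hC s hs) - c₁ s * (hA s hs - hB s hs)
  constructor
  · intro q₁ q₂ h₁ h₂
    have h := (hm.mul (h₁.sq.add h₂.sq)).sub (((hU.mul h₁).add (hV.mul h₂)).ofNat_mul 2)
    refine SignDec.sign_of_mul (hm.signDec (by norm_num)) hm0
      ((h.signDec le_rfl).congr fun s hs => ?_)
    congr 1
    linear_combination 2 * (b₁ s * c₂ s - b₂ s * c₁ s) * -hA s hs
      + 2 * q₁ s * hu s hs + 2 * q₂ s * hv s hs
  · constructor
    · intro c hc
      refine SignDec.sign_of_mul (hm.signDec (by norm_num)) hm0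
        (((hU.sub (hm.mul hc)).signDec (by norm_num)).congr fun s hs => ?_)
      congr 1
      linear_combination -hu s hs
    · intro c hc
      refine SignDec.sign_of_mul (hm.signDec (by norm_num)) hm0
        (((hV.sub (hm.mul hc)).signDec (by norm_num)).congr fun s hs => ?_)
      congr 1
      linear_combination -hv s hs
    · intro c hc
      refine SignDec.sign_of_mul ((hm.mul hm).signDec (by norm_num))
        (fun s hs => mul_self_ne_zero.2 (hm0 s hs))
        (((((hU.sub (hm.mul hc)).sq.sub hU.sq).sub hV.sq).signDec (by norm_num)).congr
          fun s hs => ?_)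
      rw [← hA s hs, ← hu s hs, ← hv s hs]
      congr 1
      ring
    · intro c hc
      refine SignDec.sign_of_mul ((hm.mul hm).signDec (by norm_num))
        (fun s hs => mul_self_ne_zero.2 (hm0 s hs))
        (((((hV.sub (hm.mul hc)).sq.sub hU.sq).sub hV.sq).signDec (by norm_num)).congr
          fun s hs => ?_)
      rw [← hA s hs, ← hu s hs, ← hv s hs]
      congr 1
      ring

/-- Circles through two points `A`, `B` that are tangent to the axis `y = 0` at a point `T`. The
orientation `w` of the triangle `A B T` is the irrationality on which the circle depends: its square
is `a₂ * b₂ * |AB| ^ 2`, and `(b₂ - a₂) * u = b₂ * a₁ - a₂ * b₁ - w`. This covers the case that `A`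
and `B` have different distances from the axis. -/
theorem CircleDec.of_two_points_tangent_of_ne {a₁ a₂ b₁ b₂ : X → ℝ} (o : ℤ) (ho : o ^ 2 = 1)
    (ha₁ : PolyFn x 1 a₁) (ha₂ : PolyFn x 1 a₂) (hb₁ : PolyFn x 1 b₁) (hb₂ : PolyFn x 1 b₂)
    (hA : ∀ s, dom s → (a₁ s - u s) ^ 2 + (a₂ s - v s) ^ 2 = v s ^ 2)
    (hB : ∀ s, dom s → (b₁ s - u s) ^ 2 + (b₂ s - v s) ^ 2 = v s ^ 2)
    (hw : ∀ s, dom s →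
      0 ≤ (o : ℝ) * ((b₁ s - a₁ s) * -a₂ s - (b₂ s - a₂ s) * (u s - a₁ s)))
    (hne : ∀ s, dom s → b₂ s - a₂ s ≠ 0) :
    CircleDec x 6 6 dom u v v := by
  have ho' : (o : ℝ) ^ 2 = 1 := by exact_mod_cast ho
  have hd := hb₂.sub ha₂
  have hN := (hb₂.mul ha₁).sub (ha₂.mul hb₁)
  have hD := (ha₂.mul hb₂).mul ((hb₁.sub ha₁).sq.add hd.sq)
  have hq : ∀ s, dom s → (b₂ s - a₂ s) * u s ^ 2 - 2 * (b₂ s * a₁ s - a₂ s * b₁ s) * u s +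
      (b₂ s * (a₁ s ^ 2 + a₂ s ^ 2) - a₂ s * (b₁ s ^ 2 + b₂ s ^ 2)) = 0 := fun s hs => by
    linear_combination b₂ s * hA s hs - a₂ s * hB s hs
  have hwD : ∀ s, dom s →
      ((o : ℝ) * ((b₁ s - a₁ s) * -a₂ s - (b₂ s - a₂ s) * (u s - a₁ s))) ^ 2 =
        a₂ s * b₂ s * ((b₁ s - a₁ s) ^ 2 + (b₂ s - a₂ s) ^ 2) := fun s hs => by
    linear_combination (b₂ s - a₂ s) * hq s hs +
      ((b₁ s - a₁ s) * -a₂ s - (b₂ s - a₂ s) * (u s - a₁ s)) ^ 2 * ho'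
  constructor
  · intro q₁ q₂ h₁ h₂
    -- Eliminating `v` and `u ^ 2` from `b₂ - a₂` times the power of the query point leaves
    -- `F - 2 * E * u`. After a second multiplication by `b₂ - a₂` this is `P + Q * w`, and
    -- `P ^ 2 - Q ^ 2 * w ^ 2` is `(b₂ - a₂) ^ 2` times `F ^ 2 + 4 * E * G`.
    have hE := ((hd.mul h₁).sub ((hb₂.sub h₂).mul ha₁)).sub ((h₂.sub ha₂).mul hb₁)
    have hF := ((hd.mul (h₁.sq.add h₂.sq)).sub ((hb₂.sub h₂).mul (ha₁.sq.add ha₂.sq))).sub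
      ((h₂.sub ha₂).mul (hb₁.sq.add hb₂.sq))
    have hM := (hb₂.mul (ha₁.sq.add ha₂.sq)).sub (ha₂.mul (hb₁.sq.add hb₂.sq))
    have hG := ((h₁.mul hM).sub ((h₁.sq.add h₂.sq).mul hN)).add (h₂.mul
      ((ha₁.mul (hb₁.sq.add hb₂.sq)).sub (hb₁.mul (ha₁.sq.add ha₂.sq))))
    have hR := hF.sq.add ((hE.mul hG).ofNat_mul 4)
    have hP := (hd.mul hF).sub ((hE.mul hN).ofNat_mul 2)
    have hQ := hE.intCast_mul (2 * o)
    refine SignDec.sign_of_mul (hd.sq.signDec (by norm_num))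
      (fun s hs => pow_ne_zero 2 (hne s hs))
      ((SignDec.sign_add_mul hP hQ hR (by norm_num) (by norm_num) (by norm_num) hw
        fun s hs => ?_).congr fun s hs => ?_)
    · rw [hwD s hs, ← one_mul (SignType.sign _),
        ← sign_pos (pow_pos (abs_pos.2 (hne s hs)) 2), ← sign_mul, sq_abs]
      congr 1
      push_cast
      linear_combination 4 * ((b₂ s - a₂ s) * q₁ s - (b₂ s - q₂ s) * a₁ s -
        (q₂ s - a₂ s) * b₁ s) ^ 2 * (a₂ s * b₂ s * ((b₁ s - a₁ s) ^ 2 + (b₂ s - a₂ s) ^ 2)) * ho'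
    · congr 1
      push_cast
      linear_combination
        2 * ((b₂ s - a₂ s) * q₁ s - (b₂ s - q₂ s) * a₁ s - (q₂ s - a₂ s) * b₁ s) *
          ((b₁ s - a₁ s) * -a₂ s - (b₂ s - a₂ s) * (u s - a₁ s)) * ho'
        - (b₂ s - a₂ s) * ((b₂ s - q₂ s) * hA s hs + (q₂ s - a₂ s) * hB s hs)
  · have hm := hd.sq.ofNat_mul 2
    have hv : QuadRep x 2 1 dom (fun s => 2 * (b₂ s - a₂ s) ^ 2) (fun s =>
        (o : ℝ) * ((b₁ s - a₁ s) * -a₂ s - (b₂ s - a₂ s) * (u s - a₁ s))) v :=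
      ⟨_, _, (hd.mul ((hb₁.sq.add hb₂.sq).sub (ha₁.sq.add ha₂.sq))).sub
          (((hb₁.sub ha₁).mul hN).ofNat_mul 2), (hb₁.sub ha₁).intCast_mul (2 * o),
        fun s hs => by
          push_cast
          linear_combination (b₂ s - a₂ s) * (hA s hs - hB s hs) - 2 * (b₁ s - a₁ s) *
            ((b₁ s - a₁ s) * -a₂ s - (b₂ s - a₂ s) * (u s - a₁ s)) * ho'⟩
    refine LineDec.of_quadratic (k := 2) hm
      (fun s hs => mul_ne_zero two_ne_zero (pow_ne_zero 2 (hne s hs)))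
      hD rfl hw hwD ⟨_, _, (hd.mul hN).ofNat_mul 2, hd.intCast_mul (-2 * o), fun s hs => ?_⟩ hv hv
    push_cast
    linear_combination 2 * (b₂ s - a₂ s) *
      ((b₁ s - a₁ s) * -a₂ s - (b₂ s - a₂ s) * (u s - a₁ s)) * ho'

/-- Circles through two distinct points that are tangent to the axis `y = 0`. -/
theorem CircleDec.of_two_points_tangent {a₁ a₂ b₁ b₂ : X → ℝ} (o : ℤ) (ho : o ^ 2 = 1)
    (ha₁ : PolyFn x 1 a₁) (ha₂ : PolyFn x 1 a₂) (hb₁ : PolyFn x 1 b₁) (hb₂ : PolyFn x 1 b₂)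
    (hA : ∀ s, dom s → (a₁ s - u s) ^ 2 + (a₂ s - v s) ^ 2 = v s ^ 2)
    (hB : ∀ s, dom s → (b₁ s - u s) ^ 2 + (b₂ s - v s) ^ 2 = v s ^ 2)
    (hw : ∀ s, dom s →
      0 ≤ (o : ℝ) * ((b₁ s - a₁ s) * -a₂ s - (b₂ s - a₂ s) * (u s - a₁ s)))
    (hAB : ∀ s, dom s → b₂ s = a₂ s → b₁ s ≠ a₁ s) :
    CircleDec x 6 6 dom u v v := by
  refine .split_eq (hb₂.sub ha₂) (by norm_num) (by norm_num) ?_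
    (.of_two_points_tangent_of_ne o ho ha₁ ha₂ hb₁ hb₂ (fun s hs => hA s hs.1)
      (fun s hs => hB s hs.1) (fun s hs => hw s hs.1) fun s hs => hs.2)
  have hu : ∀ s, dom s ∧ b₂ s - a₂ s = 0 → 2 * u s = a₁ s + b₁ s := fun s hs => by
    have hb : b₂ s = a₂ s := sub_eq_zero.1 hs.2
    refine mul_left_cancel₀ (sub_ne_zero.2 (hAB s hs.1 hb)) ?_
    have h := hB s hs.1
    rw [hb] at h
    linear_combination hA s hs.1 - h
  have hv : RatRep x 1 (fun s => dom s ∧ b₂ s - a₂ s = 0) (fun s => 8 * a₂ s) v :=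
    ⟨_, (ha₁.sub hb₁).sq.add (ha₂.sq.ofNat_mul 4), fun s hs => by
      linear_combination -4 * hA s hs.1 + (2 * a₁ s - 2 * u s + (a₁ s - b₁ s)) * -hu s hs⟩
  refine CircleDec.mono (.of_rational (ha₂.ofNat_mul 8) (fun s hs => ?_) ⟨_,
    ((ha₂.mul (ha₁.add hb₁)).ofNat_mul 4), fun s hs => ?_⟩ hv hv) (by norm_num) (by norm_num)
  · refine mul_ne_zero (by norm_num) fun h => hAB s hs.1 (sub_eq_zero.1 hs.2) ?_
    have h₁ := hA s hs.1
    rw [h] at h₁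
    have h₂ : a₁ s - u s = 0 := pow_eq_zero_iff two_ne_zero |>.1 (by linarith)
    linarith [hu s hs]
  · linear_combination 4 * a₂ s * hu s hs

/-- Circles through a point that are tangent to both coordinate axes. The last hypothesis gives the
order of the contacts; if the point lies on an axis, then `m₁`, `m₂` tell on which side of it the
segment on this axis lies. -/
theorem CircleDec.of_point_tangent_axes {a₁ a₂ m₁ m₂ : X → ℝ} (o : ℤ) (ho : o ^ 2 = 1)
    (ha₁ : PolyFn x 1 a₁) (ha₂ : PolyFn x 1 a₂) (hm₁ : PolyFn x 1 m₁) (hm₂ : PolyFn x 1 m₂)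
    (hρ : ∀ s, dom s → 0 < ρ s) (hu : ∀ s, dom s → u s ^ 2 = ρ s ^ 2)
    (hv : ∀ s, dom s → v s ^ 2 = ρ s ^ 2)
    (hA : ∀ s, dom s → (a₁ s - u s) ^ 2 + (a₂ s - v s) ^ 2 = ρ s ^ 2)
    (hw : ∀ s, dom s → 0 < (o : ℝ) * (u s * v s - a₁ s * v s - a₂ s * u s) ∨
      (a₂ s = 0 ∧ a₁ s = u s ∧ 0 < (o : ℝ) * (m₁ s * v s)) ∨
      (a₁ s = 0 ∧ a₂ s = v s ∧ 0 < (o : ℝ) * (m₂ s * u s))) :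
    CircleDec x 4 2 dom u v ρ := by
  have ho' : (o : ℝ) ^ 2 = 1 := by exact_mod_cast ho
  refine .split_sign ha₁ (hm₂.intCast_mul o) (by norm_num) (by norm_num) hρ hu
    (fun s hs => ?_) fun ε hε => .split_sign ha₂ (hm₁.intCast_mul o) (by norm_num) (by norm_num)
      (fun s hs => hρ s hs.1) (fun s hs => hv s hs.1) (fun s hs => ?_) fun ε' hε' => ?_
  · by_cases h : a₁ s = 0
    · refine .inr ⟨h, ?_⟩
      have hA := hA s hs
      have h₂ : a₂ s = v s := sub_eq_zero.1 (pow_eq_zero_iff two_ne_zero |>.1 (by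
        rw [h] at hA
        linarith [hu s hs]))
      rcases hw s hs with h' | ⟨-, h', -⟩ | h'
      · rw [h, h₂] at h'
        ring_nf at h'
        exact absurd h' (lt_irrefl _)
      · have := hu s hs
        rw [← h', h] at this
        nlinarith [hρ s hs]
      · linarith [h'.2.2]
    · left
      nlinarith [hA s hs, hu s hs, sq_nonneg (a₂ s - v s), pow_pos (abs_pos.2 h) 2, sq_abs (a₁ s)]
  · replace hs := hs.1
    by_cases h : a₂ s = 0
    · refine .inr ⟨h, ?_⟩
      have hA := hA s hs
      have h₂ : a₁ s = u s := sub_eq_zero.1 (pow_eq_zero_iff two_ne_zero |>.1 (by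
        rw [h] at hA
        linarith [hv s hs]))
      rcases hw s hs with h' | h' | ⟨-, h', -⟩
      · rw [h, h₂] at h'
        ring_nf at h'
        exact absurd h' (lt_irrefl _)
      · linarith [h'.2.2]
      · have := hv s hs
        rw [← h', h] at this
        nlinarith [hρ s hs]
    · left
      nlinarith [hA s hs, hv s hs, sq_nonneg (a₁ s - u s), pow_pos (abs_pos.2 h) 2, sq_abs (a₂ s)]
  · -- With `u = ε * ρ` and `v = ε' * ρ`, the radius is a root of
    -- `ρ ^ 2 - 2 * (ε * a₁ + ε' * a₂) * ρ + a₁ ^ 2 + a₂ ^ 2`.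
    have hε : (ε : ℝ) ^ 2 = 1 := by exact_mod_cast hε
    have hε' : (ε' : ℝ) ^ 2 = 1 := by exact_mod_cast hε'
    have hall : ((o : ℝ) * ε * ε') ^ 2 = 1 := by
      rw [mul_pow, mul_pow, ho', hε, hε', one_mul, one_mul]
    have hL := (ha₁.intCast_mul ε).add (ha₂.intCast_mul ε')
    have key : ∀ s, (dom s ∧ u s = ε * ρ s) ∧ v s = ε' * ρ s →
        0 ≤ ((o * ε * ε' : ℤ) : ℝ) * (ρ s - (ε * a₁ s + ε' * a₂ s)) := fun s hs => by
      refine le_of_mul_le_mul_left ?_ (hρ s hs.1.1)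
      have h : ρ s * (((o * ε * ε' : ℤ) : ℝ) * (ρ s - (ε * a₁ s + ε' * a₂ s))) =
          o * (u s * v s - a₁ s * v s - a₂ s * u s) := by
        rw [hs.1.2, hs.2]
        push_cast
        linear_combination (-ρ s * o * ε' * a₁ s) * hε - ρ s * o * ε * a₂ s * hε'
      rw [h, mul_zero]
      rcases hw s hs.1.1 with h | ⟨h₁, h₂, -⟩ | ⟨h₁, h₂, -⟩
      · exact h.le
      · rw [h₁, h₂]
        exact le_of_eq (by ring)
      · rw [h₁, h₂]
        exact le_of_eq (by ring)
    refine .of_quadratic (k := 0) (j := 0) (m := fun _ => 1) PolyFn.one (fun _ _ => one_ne_zero)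
      (((ha₁.mul ha₂).intCast_mul (2 * ε * ε'))) rfl key (fun s hs => ?_)
      ⟨_, _, hL.intCast_mul ε, PolyFn.intCast (o * ε'), fun s hs => ?_⟩
      ⟨_, _, hL.intCast_mul ε', PolyFn.intCast (o * ε), fun s hs => ?_⟩
      ⟨_, _, hL, PolyFn.intCast (o * ε * ε'), fun s hs => ?_⟩
    · have h := hA s hs.1.1
      rw [hs.1.2, hs.2] at h
      push_cast
      linear_combination h + (ρ s - (ε * a₁ s + ε' * a₂ s)) ^ 2 * hall +
        (a₁ s ^ 2 - ρ s ^ 2) * hε + (a₂ s ^ 2 - ρ s ^ 2) * hε'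
    · rw [hs.1.2]
      push_cast
      linear_combination -ε * (ρ s - (ε * a₁ s + ε' * a₂ s)) * (ε' ^ 2 * ho' + hε')
    · rw [hs.2]
      push_cast
      linear_combination -ε' * (ρ s - (ε * a₁ s + ε' * a₂ s)) * (ε ^ 2 * ho' + hε)
    · push_cast
      linear_combination -(ρ s - (ε * a₁ s + ε' * a₂ s)) * hall

/-- Circles through a point that are tangent to the lines `y = 0` and `y = h`, where `h ≠ 0`. -/
theorem CircleDec.of_point_tangent_parallel {a₁ a₂ h : X → ℝ} (o : ℤ) (ho : o ^ 2 = 1)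
    (ha₁ : PolyFn x 1 a₁) (ha₂ : PolyFn x 1 a₂) (hh : PolyFn x 1 h)
    (hh0 : ∀ s, dom s → h s ≠ 0) (hv : ∀ s, dom s → v s ^ 2 = ρ s ^ 2)
    (hvh : ∀ s, dom s → (v s - h s) ^ 2 = ρ s ^ 2)
    (hA : ∀ s, dom s → (a₁ s - u s) ^ 2 + (a₂ s - v s) ^ 2 = ρ s ^ 2)
    (hw : ∀ s, dom s → 0 ≤ (o : ℝ) * (h s * (u s - a₁ s))) :
    CircleDec x 4 2 dom u v ρ := by
  have ho' : (o : ℝ) ^ 2 = 1 := by exact_mod_cast ho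
  have hv2 : ∀ s, dom s → 2 * v s = h s := fun s hs => by
    refine mul_left_cancel₀ (hh0 s hs) ?_
    linear_combination hv s hs - hvh s hs
  refine .congr_radius ?_ hv
  have key : ∀ ε : ℤ, ε ^ 2 = 1 → CircleDec x 4 2 (fun s => dom s ∧ 0 < ε * h s) u v v := by
    intro ε hε
    have hε' : (ε : ℝ) ^ 2 = 1 := by exact_mod_cast hε
    have hv' : QuadRep x 0 0 (fun s => dom s ∧ 0 < ε * h s) (fun _ => 2)
        (fun s => ((o * ε : ℤ) : ℝ) * (u s - a₁ s)) v :=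
      ⟨_, _, hh, PolyFn.zero, fun s hs => by rw [hv2 s hs.1, zero_mul, add_zero]⟩
    refine .of_quadratic (k := 0) (j := 0) (PolyFn.ofNat 2) (fun _ _ => two_ne_zero)
      (ha₂.mul (hh.sub ha₂)) rfl (fun s hs => ?_) (fun s hs => ?_)
      ⟨_, _, ha₁.ofNat_mul 2, PolyFn.intCast (2 * (o * ε)), fun s hs => ?_⟩ hv' hv'
    · refine le_of_mul_le_mul_left ?_ hs.2
      have h' : ε * h s * (((o * ε : ℤ) : ℝ) * (u s - a₁ s)) = o * (h s * (u s - a₁ s)) := by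
        push_cast
        linear_combination o * h s * (u s - a₁ s) * hε'
      rw [mul_zero, h']
      exact hw s hs.1
    · push_cast
      linear_combination hA s hs.1 - hv s hs.1 + a₂ s * hv2 s hs.1 +
        (u s - a₁ s) ^ 2 * (ε ^ 2 * ho' + hε')
    · push_cast
      linear_combination -2 * (u s - a₁ s) * (ε ^ 2 * ho' + hε')
  exact .split hh (by norm_num) (by norm_num)
    ((key (-1) (by norm_num)).restrict fun s hs => ⟨hs.1, by push_cast; linarith [hs.2]⟩)
    ((key 1 (by norm_num)).restrict fun s hs => absurd hs.2 (hh0 s hs.1))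
    ((key 1 (by norm_num)).restrict fun s hs => ⟨hs.1, by push_cast; linarith [hs.2]⟩)

/-- Circles that are tangent to the axis `y = 0` at a given point `(t, 0)`, and that go through
another given point. -/
theorem CircleDec.of_point_tangent_at {a₁ a₂ t : X → ℝ}
    (ha₁ : PolyFn x 1 a₁) (ha₂ : PolyFn x 1 a₂) (ht : PolyFn x 1 t)
    (ha0 : ∀ s, dom s → a₂ s ≠ 0) (hv : ∀ s, dom s → v s ^ 2 = ρ s ^ 2)
    (hA : ∀ s, dom s → (a₁ s - u s) ^ 2 + (a₂ s - v s) ^ 2 = ρ s ^ 2)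
    (hu : ∀ s, dom s → u s = t s) :
    CircleDec x 4 2 dom u v ρ := by
  have hv' : RatRep x 1 dom (fun s => 2 * a₂ s) v :=
    ⟨_, (ha₁.sub ht).sq.add ha₂.sq, fun s hs => by
      rw [← hu s hs]
      linear_combination hv s hs - hA s hs⟩
  exact .congr_radius (.of_rational (k := 1) (ha₂.ofNat_mul 2)
    (fun s hs => mul_ne_zero two_ne_zero (ha0 s hs))
    ⟨_, (ha₂.ofNat_mul 2).mul ht, fun s hs => by rw [hu s hs]⟩ hv' hv') hv

/-- Circles that are tangent to the axis `y = 0` at a given point `(t, 0)`, and to the parallel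
line `y = h`, where `h ≠ 0`. -/
theorem CircleDec.of_tangent_at_parallel {h t : X → ℝ} (hh : PolyFn x 1 h) (ht : PolyFn x 1 t)
    (hh0 : ∀ s, dom s → h s ≠ 0) (hv : ∀ s, dom s → v s ^ 2 = ρ s ^ 2)
    (hvh : ∀ s, dom s → (v s - h s) ^ 2 = ρ s ^ 2) (hu : ∀ s, dom s → u s = t s) :
    CircleDec x 2 1 dom u v ρ := by
  have hv' : RatRep x 0 dom (fun _ => 2) v := ⟨_, hh, fun s hs => by
    refine mul_left_cancel₀ (hh0 s hs) ?_
    linear_combination hv s hs - hvh s hs⟩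
  exact .congr_radius (.of_rational (k := 0) (PolyFn.ofNat 2) (fun _ _ => two_ne_zero)
    ⟨_, ht.ofNat_mul 2, fun s hs => by rw [hu s hs]⟩ hv' hv') hv

/-- Circles that are tangent to the axis `y = 0` at a given point `(t, 0)`, and to the axis
`x = 0`. The sign of `n` determines on which side of the axis `y = 0` the centre lies. -/
theorem CircleDec.of_tangent_at_perpendicular {n t : X → ℝ} (hn : PolyFn x 1 n)
    (ht : PolyFn x 1 t) (hρ : ∀ s, dom s → 0 < ρ s) (huρ : ∀ s, dom s → u s ^ 2 = ρ s ^ 2)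
    (hv : ∀ s, dom s → v s ^ 2 = ρ s ^ 2) (hu : ∀ s, dom s → u s = t s)
    (hnv : ∀ s, dom s → 0 < n s * v s) :
    CircleDec x 2 1 dom u v ρ := by
  refine .split_sign hn hn (by norm_num) (by norm_num) hρ hv (fun s hs => .inl (hnv s hs))
    fun ε hε => .split_sign ht ht (by norm_num) (by norm_num) (fun s hs => hρ s hs.1)
      (fun s hs => huρ s hs.1) (fun s hs => .inl ?_) fun ε' hε' => ?_
  · rw [← hu s hs.1, ← pow_two, huρ s hs.1]
    exact pow_pos (hρ s hs.1) 2
  · have hε : (ε : ℝ) ^ 2 = 1 := by exact_mod_cast hε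
    have hε' : (ε' : ℝ) ^ 2 = 1 := by exact_mod_cast hε'
    have hv' : RatRep x 0 (fun s => (dom s ∧ v s = ε * ρ s) ∧ u s = ε' * ρ s) (fun _ => 1) v :=
      ⟨_, ht.intCast_mul (ε * ε'), fun s hs => by
        rw [← hu s hs.1.1, hs.2, hs.1.2]
        push_cast
        linear_combination -ε * ρ s * hε'⟩
    exact .congr_radius (.of_rational (k := 0) PolyFn.one (fun _ _ => one_ne_zero)
      ⟨_, ht, fun s hs => by rw [hu s hs.1.1, one_mul]⟩ hv' hv') fun s hs => hv s hs.1.1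

/-- Circles that are tangent to the lines `y = 0`, `y = h` and `x = 0`, where `h ≠ 0`. -/
theorem CircleDec.of_tangent_parallel_perpendicular {h : X → ℝ} (o : ℤ) (ho : o ^ 2 = 1)
    (hh : PolyFn x 1 h) (hh0 : ∀ s, dom s → h s ≠ 0) (huρ : ∀ s, dom s → u s ^ 2 = ρ s ^ 2)
    (hv : ∀ s, dom s → v s ^ 2 = ρ s ^ 2) (hvh : ∀ s, dom s → (v s - h s) ^ 2 = ρ s ^ 2)
    (hw : ∀ s, dom s → 0 < (o : ℝ) * (h s * u s)) :
    CircleDec x 2 1 dom u v ρ := by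
  have ho' : (o : ℝ) ^ 2 = 1 := by exact_mod_cast ho
  have hv2 : ∀ s, dom s → 2 * v s = h s := fun s hs => by
    refine mul_left_cancel₀ (hh0 s hs) ?_
    linear_combination hv s hs - hvh s hs
  have hv' : RatRep x 0 dom (fun _ => 2) v := ⟨_, hh, hv2⟩
  refine .congr_radius (.of_rational (k := 0) (PolyFn.ofNat 2) (fun _ _ => two_ne_zero)
    ⟨_, hh.intCast_mul o, fun s hs => ?_⟩ hv' hv') hv
  have h₁ : (2 * u s - o * h s) * (2 * u s + o * h s) = 0 := by
    linear_combination 4 * huρ s hs - 4 * hv s hs + (2 * v s + h s) * hv2 s hs - h s ^ 2 * ho'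
  rcases mul_eq_zero.1 h₁ with h₂ | h₂
  · exact sub_eq_zero.1 h₂
  · exfalso
    have h₃ : (o : ℝ) * (h s * u s) = -2 * u s ^ 2 := by linear_combination u s * h₂
    linarith [hw s hs, sq_nonneg (u s)]

end Families

/-! ### Axes-aligned sites -/

theorem Fin.eq_or_eq_of_ne {i j : Fin 2} (hij : i ≠ j) (k : Fin 2) : k = i ∨ k = j := by
  omega

/-- The sign by which the orientation changes when the coordinate `i` is listed first. -/
def axisSign (i : Fin 2) : ℤ := if i = 0 then 1 else -1

theorem axisSign_sq (i : Fin 2) : axisSign i ^ 2 = 1 := by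
  unfold axisSign
  split_ifs <;> norm_num

theorem orient_eq {i j : Fin 2} (hij : i ≠ j) (p q r : EPlane) :
    orient p q r = axisSign i * ((q i - p i) * (r j - p j) - (q j - p j) * (r i - p i)) := by
  fin_cases i <;> fin_cases j <;> simp [orient, axisSign] at hij ⊢

theorem orient_rotate (p q r : EPlane) : orient q r p = orient p q r := by
  unfold orient
  ring

theorem dist_sq_eq {i j : Fin 2} (hij : i ≠ j) (p q : EPlane) :
    dist p q ^ 2 = (p i - q i) ^ 2 + (p j - q j) ^ 2 := by
  rw [EuclideanSpace.dist_sq_eq, Fin.sum_univ_two, Real.dist_eq, Real.dist_eq, sq_abs, sq_abs]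
  fin_cases i <;> fin_cases j <;> simp [add_comm] at hij ⊢

namespace VSite

/-- The site is a non-degenerate segment in the direction of the `i`-th coordinate axis. -/
def Along (S : VSite) (i : Fin 2) : Prop :=
  S.kind = SiteKind.segment ∧ S.coord 0 i ≠ S.coord 1 i ∧
    ∀ j, j ≠ i → S.coord 0 j = S.coord 1 j

variable {S S' : VSite} {K p : EPlane} {ρ : ℝ} {i j : Fin 2}

theorem AxesAligned.along (h : S.AxesAligned) (hS : S.kind = SiteKind.segment) :
    S.coord 0 1 - S.coord 1 1 = 0 ∧ S.Along 0 ∨ S.coord 0 1 - S.coord 1 1 ≠ 0 ∧ S.Along 1 := by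
  cases S with
  | point A => cases hS
  | segment C D =>
    have hne : ¬(C 0 = D 0 ∧ C 1 = D 1) := fun h' => h.1 (by
      ext k
      fin_cases k
      exacts [h'.1, h'.2])
    by_cases h1 : C 1 = D 1
    · refine .inl ⟨sub_eq_zero.2 h1, rfl, fun h0 => hne ⟨h0, h1⟩, fun k hk => ?_⟩
      fin_cases k
      exacts [absurd rfl hk, h1]
    · refine .inr ⟨sub_ne_zero.2 h1, rfl, h1, fun k hk => ?_⟩
      fin_cases k
      exacts [h.2.resolve_right h1, absurd rfl hk]

theorem TouchedAt.of_point (hS : S.kind = SiteKind.point) (h : S.TouchedAt K ρ p) :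
    p = S.rep ∧ (∀ k, p k = S.coord 0 k) ∧ dist p K ^ 2 = ρ ^ 2 := by
  cases S with
  | point A => exact ⟨h.1, fun k => by rw [h.1]; rfl, by rw [dist_comm, h.2]⟩
  | segment C D => cases hS

theorem Along.rep (hS : S.Along i) (hij : i ≠ j) :
    2 * S.rep i = S.coord 0 i + S.coord 1 i ∧ S.rep j = S.coord 0 j := by
  cases S with
  | point A => cases hS.1
  | segment C D =>
    have hj : C j = D j := hS.2.2 j hij.symm
    have h : ∀ k, 2 * (midpoint ℝ C D) k = C k + D k := fun k => by
      rw [midpoint_eq_smul_add]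
      simp
      ring
    refine ⟨h i, ?_⟩
    change (midpoint ℝ C D) j = C j
    linarith [h j]

theorem Along.touchedAt (hS : S.Along i) (hij : i ≠ j) (h : S.TouchedAt K ρ p) :
    p i = K i ∧ p j = S.coord 0 j ∧ (K j - S.coord 0 j) ^ 2 = ρ ^ 2 ∧
      (K i - S.coord 0 i) * (K i - S.coord 1 i) ≤ 0 := by
  cases S with
  | point A => cases hS.1
  | segment C D =>
    obtain ⟨-, hi, hj⟩ := hS
    replace hj : C j = D j := hj j hij.symm
    replace hi : C i ≠ D i := hi
    obtain ⟨⟨a, b, ha, hb, hab, rfl⟩, hd, hp⟩ := h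
    have hk : ∀ k, (a • C + b • D) k = a * C k + b * D k := fun k => by simp
    have hpj : (a • C + b • D) j = C j := by
      rw [hk, ← hj, ← add_mul, hab, one_mul]
    have hpi : (a • C + b • D) i = K i := by
      have h : ((a • C + b • D) i - K i) * (D i - C i) +
          ((a • C + b • D) j - K j) * (D j - C j) = 0 := by
        rw [← hp, EuclideanSpace.inner_eq_star_dotProduct]
        fin_cases i <;> fin_cases j <;> simp [dotProduct, Fin.sum_univ_two] at hij ⊢ <;> ring
      rw [← hj, sub_self, mul_zero, add_zero] at h
      exact sub_eq_zero.1 ((mul_eq_zero.1 h).resolve_right (sub_ne_zero.2 hi.symm))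
    refine ⟨hpi, hpj, ?_, ?_⟩
    · have h := dist_sq_eq hij K (a • C + b • D)
      rw [hd, hpi, hpj, sub_self] at h
      change (K j - C j) ^ 2 = ρ ^ 2
      linarith
    · change (K i - C i) * (K i - D i) ≤ 0
      rw [← hpi, hk]
      have ha' : a = 1 - b := by linarith
      have h : (a * C i + b * D i - C i) * (a * C i + b * D i - D i) =
          -(a * b * (C i - D i) ^ 2) := by
        rw [ha']
        ring
      rw [h]
      exact neg_nonpos.2 (mul_nonneg (mul_nonneg ha hb) (sq_nonneg _))

theorem Along.mem_carrier (hS : S.Along i) (hij : i ≠ j) :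
    p ∈ S.carrier ↔ p j = S.coord 0 j ∧ (p i - S.coord 0 i) * (p i - S.coord 1 i) < 0 := by
  cases S with
  | point A => cases hS.1
  | segment C D =>
    obtain ⟨-, hi, hj⟩ := hS
    replace hj : C j = D j := hj j hij.symm
    replace hi : C i ≠ D i := hi
    change p ∈ openSegment ℝ C D ↔ p j = C j ∧ (p i - C i) * (p i - D i) < 0
    rw [openSegment_eq_image]
    constructor
    · rintro ⟨t, ⟨h0, h1⟩, rfl⟩
      have hk : ∀ k, ((1 - t) • C + t • D) k = (1 - t) * C k + t * D k := fun k => by simp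
      refine ⟨by rw [hk, ← hj]; ring, ?_⟩
      rw [hk]
      have h : ((1 - t) * C i + t * D i - C i) * ((1 - t) * C i + t * D i - D i) =
          -(t * (1 - t) * (C i - D i) ^ 2) := by ring
      rw [h]
      exact neg_neg_of_pos (mul_pos (mul_pos h0 (sub_pos.2 h1))
        (pow_pos (abs_pos.2 (sub_ne_zero.2 hi)) 2 |>.trans_eq (sq_abs _)))
    · rintro ⟨hpj, hpi⟩
      have hne : D i - C i ≠ 0 := sub_ne_zero.2 hi.symm
      have ht : (p i - C i) / (D i - C i) * (D i - C i) = p i - C i := div_mul_cancel₀ _ hne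
      refine ⟨(p i - C i) / (D i - C i), ?_, ?_⟩
      · rcases lt_or_gt_of_ne hne with hlt | hlt
        · have h₁ : p i - C i < 0 := by nlinarith
          exact ⟨div_pos_of_neg_of_neg h₁ hlt, (div_lt_one_of_neg hlt).2 (by nlinarith)⟩
        · have h₁ : 0 < p i - C i := by nlinarith
          exact ⟨div_pos h₁ hlt, (div_lt_one hlt).2 (by nlinarith)⟩
      · ext k
        rcases Fin.eq_or_eq_of_ne hij k with rfl | rfl
        · simp only [PiLp.add_apply, PiLp.smul_apply, smul_eq_mul]
          linear_combination ht
        · simp only [PiLp.add_apply, PiLp.smul_apply, smul_eq_mul]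
          rw [hpj, ← hj]
          ring

/-- Two open intervals without a common point lie on different sides of some number. -/
theorem le_or_le_of_disjoint_Ioo {a b c d : ℝ} (hab : a < b) (hcd : c < d)
    (h : ∀ y, (y - a) * (y - b) < 0 → ¬(y - c) * (y - d) < 0) : b ≤ c ∨ d ≤ a := by
  by_contra! h'
  have h₁ : max a c < min b d := max_lt (lt_min hab h'.2) (lt_min h'.1 hcd)
  obtain ⟨y, hy₁, hy₂⟩ := exists_between h₁
  obtain ⟨ha, hc⟩ := max_lt_iff.1 hy₁
  obtain ⟨hb, hd⟩ := lt_min_iff.1 hy₂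
  exact h y (mul_neg_of_pos_of_neg (sub_pos.2 ha) (sub_neg.2 hb))
    (mul_neg_of_pos_of_neg (sub_pos.2 hc) (sub_neg.2 hd))

/-- If a circle touches two disjoint collinear segments, then it touches them in a common
endpoint. -/
theorem Along.touch_common (hS : S.Along i) (hS' : S'.Along i) (hij : i ≠ j)
    (hj : S.coord 0 j = S'.coord 0 j) (hdis : Disjoint S.carrier S'.carrier) {t : ℝ}
    (ht : (t - S.coord 0 i) * (t - S.coord 1 i) ≤ 0)
    (ht' : (t - S'.coord 0 i) * (t - S'.coord 1 i) ≤ 0) :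
    ((S.coord 0 i - S'.coord 0 i = 0 ∨ S.coord 0 i - S'.coord 1 i = 0) ∧ t = S.coord 0 i) ∨
      (S.coord 0 i - S'.coord 0 i ≠ 0 ∧ S.coord 0 i - S'.coord 1 i ≠ 0 ∧ t = S.coord 1 i) := by
  have key : ∀ y, (y - S.coord 0 i) * (y - S.coord 1 i) < 0 →
      ¬(y - S'.coord 0 i) * (y - S'.coord 1 i) < 0 := by
    intro y h₁ h₂
    let q : EPlane := WithLp.toLp 2 (fun k => if k = i then y else S.coord 0 j)
    have hqi : q i = y := by simp [q]
    have hqj : q j = S.coord 0 j := by simp [q, hij.symm]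
    refine Set.disjoint_left.1 hdis ((hS.mem_carrier hij).2 ⟨hqj, ?_⟩)
      ((hS'.mem_carrier hij).2 ⟨hqj.trans hj, ?_⟩) <;> rwa [hqi]
  have hne := hS.2.1
  have hne' := hS'.2.1
  have bounds : ∀ {a b y : ℝ}, a < b → (y - a) * (y - b) ≤ 0 → a ≤ y ∧ y ≤ b := fun hab h =>
    ⟨by by_contra! h'; nlinarith, by by_contra! h'; nlinarith⟩
  generalize S.coord 0 i = a at *
  generalize S.coord 1 i = b at *
  generalize S'.coord 0 i = c at *
  generalize S'.coord 1 i = d at *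
  rcases lt_or_gt_of_ne hne with hab | hab <;> rcases lt_or_gt_of_ne hne' with hcd | hcd
  · obtain ⟨h₁, h₂⟩ := bounds hab ht
    obtain ⟨h₃, h₄⟩ := bounds hcd ht'
    rcases le_or_le_of_disjoint_Ioo hab hcd key with h | h
    · exact .inr ⟨by linarith, by linarith, by linarith⟩
    · exact .inl ⟨.inr (by linarith), by linarith⟩
  · obtain ⟨h₁, h₂⟩ := bounds hab ht
    obtain ⟨h₃, h₄⟩ := bounds hcd (by rwa [mul_comm])
    rcases le_or_le_of_disjoint_Ioo hab hcd (fun y hy => by rw [mul_comm]; exact key y hy) with h | h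
    · exact .inr ⟨by linarith, by linarith, by linarith⟩
    · exact .inl ⟨.inl (by linarith), by linarith⟩
  · obtain ⟨h₁, h₂⟩ := bounds hab (by rwa [mul_comm])
    obtain ⟨h₃, h₄⟩ := bounds hcd ht'
    rcases le_or_le_of_disjoint_Ioo hab hcd
      (fun y hy => key y (by rwa [mul_comm])) with h | h
    · exact .inl ⟨.inl (by linarith), by linarith⟩
    · exact .inr ⟨by linarith, by linarith, by linarith⟩
  · obtain ⟨h₁, h₂⟩ := bounds hab (by rwa [mul_comm])
    obtain ⟨h₃, h₄⟩ := bounds hcd (by rwa [mul_comm])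
    rcases le_or_le_of_disjoint_Ioo hab hcd
      (fun y hy => by rw [mul_comm]; exact key y (by rwa [mul_comm])) with h | h
    · exact .inl ⟨.inr (by linarith), by linarith⟩
    · exact .inr ⟨by linarith, by linarith, by linarith⟩

end VSite

/-! ### The value of the predicate -/

theorem between_or_sq_lt {a b y : ℝ} (hy : (y - a) * (y - b) < 0) (k : ℝ) :
    (k - a) * (k - b) < 0 ∨ (a - k) ^ 2 < (y - k) ^ 2 ∨ (b - k) ^ 2 < (y - k) ^ 2 := by
  by_contra! h
  obtain ⟨h₁, h₂, h₃⟩ := h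
  rcases mul_neg_iff.1 hy with ⟨ha, hb⟩ | ⟨ha, hb⟩
  · have h₄ : a + y ≤ 2 * k := by nlinarith
    have h₅ : 2 * k ≤ b + y := by nlinarith
    nlinarith
  · have h₄ : 2 * k ≤ a + y := by nlinarith
    have h₅ : b + y ≤ 2 * k := by nlinarith
    nlinarith

theorem exists_between_sq_add_lt {a b k e R : ℝ} (hab : a ≠ b) (h : (a - k) ^ 2 + e < R) :
    ∃ y, (y - a) * (y - b) < 0 ∧ (y - k) ^ 2 + e < R := by
  have hcont : Continuous fun t : ℝ => (a + t * (b - a) - k) ^ 2 + e := by fun_prop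
  have hlt : ∀ᶠ t : ℝ in nhdsWithin 0 (Set.Ioi 0), (a + t * (b - a) - k) ^ 2 + e < R :=
    (hcont.tendsto 0).eventually (gt_mem_nhds (by simpa using h)) |>.filter_mono
      nhdsWithin_le_nhds
  obtain ⟨t, ht, h0, h1⟩ := (hlt.and (Ioo_mem_nhdsGT one_pos)).exists
  refine ⟨a + t * (b - a), ?_, ht⟩
  have h : (a + t * (b - a) - a) * (a + t * (b - a) - b) = -(t * (1 - t) * (b - a) ^ 2) := by ring
  rw [h]
  exact neg_neg_of_pos (mul_pos (mul_pos h0 (sub_pos.2 h1))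
    (pow_pos (abs_pos.2 (sub_ne_zero.2 hab.symm)) 2 |>.trans_eq (sq_abs _)))

open VSite in
theorem incircleValue_point {O : VSite} (hO : O.kind = SiteKind.point) (K : EPlane) {ρ : ℝ}
    (hρ : 0 < ρ) :
    incircleValue K ρ O =
      SignType.sign ((O.coord 0 0 - K 0) ^ 2 + (O.coord 0 1 - K 1) ^ 2 - ρ ^ 2) := by
  cases O with
  | segment C D => cases hO
  | point A =>
    change incircleValue K ρ (point A) = SignType.sign ((A 0 - K 0) ^ 2 + (A 1 - K 1) ^ 2 - ρ ^ 2)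
    rw [← dist_sq_eq (i := 0) (j := 1) (by decide)]
    unfold incircleValue
    simp only [carrier, Set.singleton_inter_nonempty, Metric.mem_ball, Metric.mem_sphere]
    rcases lt_trichotomy (dist A K) ρ with h | h | h
    · rw [if_pos h, sign_neg (by nlinarith [dist_nonneg (x := A) (y := K)])]
    · rw [if_neg h.not_lt, if_pos h, h, sub_self, sign_zero]
    · rw [if_neg h.le.not_gt, if_neg h.ne', sign_pos (by nlinarith)]

/-- The value of the predicate for a query segment: `s₀`, `s₁` are the values for its endpoints,
`f` tells whether the projection of the centre to the line of the segment lies on the segment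
(negative), and `l` tells whether this line is a secant (negative), a tangent (zero), or does not
meet the circle. -/
def segmentValue (s₀ s₁ f l : SignType) : SignType :=
  if s₀ = -1 ∨ s₁ = -1 ∨ (f = -1 ∧ l = -1) then -1 else if f = -1 ∧ l = 0 then 0 else 1

theorem VSite.Along.incircleValue_eq {O : VSite} {i j : Fin 2} (hO : O.Along i) (hij : i ≠ j)
    (K : EPlane) {ρ : ℝ} (hρ : 0 < ρ) :
    incircleValue K ρ O = segmentValue
      (SignType.sign ((O.coord 0 i - K i) ^ 2 + (O.coord 0 j - K j) ^ 2 - ρ ^ 2))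
      (SignType.sign ((O.coord 1 i - K i) ^ 2 + (O.coord 0 j - K j) ^ 2 - ρ ^ 2))
      (SignType.sign ((K i - O.coord 0 i) * (K i - O.coord 1 i)))
      (SignType.sign ((K j - O.coord 0 j) ^ 2 - ρ ^ 2)) := by
  have hball : ∀ p : EPlane, p ∈ Metric.ball K ρ ↔ (p i - K i) ^ 2 + (p j - K j) ^ 2 < ρ ^ 2 :=
    fun p => by
      rw [← dist_sq_eq hij, Metric.mem_ball, sq_lt_sq₀ dist_nonneg hρ.le]
  have hsphere : ∀ p : EPlane,
      p ∈ Metric.sphere K ρ ↔ (p i - K i) ^ 2 + (p j - K j) ^ 2 = ρ ^ 2 := fun p => by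
    rw [← dist_sq_eq hij, Metric.mem_sphere, sq_eq_sq₀ dist_nonneg hρ.le]
  have hex : ∀ P : ℝ → ℝ → Prop, (∃ p ∈ O.carrier, P (p i) (p j)) ↔
      ∃ y, (y - O.coord 0 i) * (y - O.coord 1 i) < 0 ∧ P y (O.coord 0 j) := fun P => by
    constructor
    · rintro ⟨p, hp, h⟩
      obtain ⟨h₁, h₂⟩ := (hO.mem_carrier hij).1 hp
      exact ⟨p i, h₂, h₁ ▸ h⟩
    · rintro ⟨y, hy, h⟩
      let q : EPlane := WithLp.toLp 2 (fun k => if k = i then y else O.coord 0 j)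
      have hqi : q i = y := by simp [q]
      have hqj : q j = O.coord 0 j := by simp [q, hij.symm]
      exact ⟨q, (hO.mem_carrier hij).2 ⟨hqj, by rwa [hqi]⟩, by rwa [hqi, hqj]⟩
  have h₁ : (O.carrier ∩ Metric.ball K ρ).Nonempty ↔
      ∃ y, (y - O.coord 0 i) * (y - O.coord 1 i) < 0 ∧
        (y - K i) ^ 2 + (O.coord 0 j - K j) ^ 2 < ρ ^ 2 := by
    rw [← hex fun y z => (y - K i) ^ 2 + (z - K j) ^ 2 < ρ ^ 2]
    exact exists_congr fun p => and_congr Iff.rfl (hball p)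
  have h₂ : (O.carrier ∩ Metric.sphere K ρ).Nonempty ↔
      ∃ y, (y - O.coord 0 i) * (y - O.coord 1 i) < 0 ∧
        (y - K i) ^ 2 + (O.coord 0 j - K j) ^ 2 = ρ ^ 2 := by
    rw [← hex fun y z => (y - K i) ^ 2 + (z - K j) ^ 2 = ρ ^ 2]
    exact exists_congr fun p => and_congr Iff.rfl (hsphere p)
  have hne := hO.2.1
  unfold incircleValue segmentValue
  simp only [sign_eq_neg_one_iff, sign_eq_zero_iff, sub_neg, sub_eq_zero]
  rw [sub_sq_comm (K j)]
  generalize (O.coord 0 j - K j) ^ 2 = e at h₁ h₂ ⊢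
  generalize O.coord 0 i = a at h₁ h₂ hne ⊢
  generalize O.coord 1 i = b at h₁ h₂ hne ⊢
  generalize K i = k at h₁ h₂ ⊢
  have hlt : (∃ y, (y - a) * (y - b) < 0 ∧ (y - k) ^ 2 + e < ρ ^ 2) ↔
      (a - k) ^ 2 + e < ρ ^ 2 ∨ (b - k) ^ 2 + e < ρ ^ 2 ∨ (k - a) * (k - b) < 0 ∧ e < ρ ^ 2 := by
    constructor
    · rintro ⟨y, hy, h⟩
      rcases between_or_sq_lt hy k with h' | h' | h'
      · exact .inr (.inr ⟨h', by linarith [sq_nonneg (y - k)]⟩)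
      · exact .inl (by linarith)
      · exact .inr (.inl (by linarith))
    · rintro (h | h | ⟨h, h'⟩)
      · exact exists_between_sq_add_lt hne h
      · obtain ⟨y, hy, h⟩ := exists_between_sq_add_lt hne.symm h
        exact ⟨y, by rwa [mul_comm], h⟩
      · exact ⟨k, h, by rwa [sub_self, zero_pow two_ne_zero, zero_add]⟩
  by_cases h : ∃ y, (y - a) * (y - b) < 0 ∧ (y - k) ^ 2 + e < ρ ^ 2
  · rw [if_pos (h₁.2 h), if_pos (hlt.1 h)]
  · rw [if_neg (mt h₁.1 h), if_neg (mt hlt.2 h)]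
    have heq : (O.carrier ∩ Metric.sphere K ρ).Nonempty ↔ (k - a) * (k - b) < 0 ∧ e = ρ ^ 2 := by
      refine h₂.trans ⟨?_, fun h' => ⟨k, h'.1, by rw [h'.2]; ring⟩⟩
      rintro ⟨y, hy, h'⟩
      have hn := mt hlt.2 h
      push Not at hn
      rcases between_or_sq_lt hy k with h₀ | h₀ | h₀
      · exact ⟨h₀, le_antisymm (by linarith [sq_nonneg (y - k)]) (hn.2.2 h₀)⟩
      · linarith [hn.1]
      · linarith [hn.2.1]
    by_cases h' : (k - a) * (k - b) < 0 ∧ e = ρ ^ 2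
    · rw [if_pos h', if_pos (heq.2 h')]
    · rw [if_neg h', if_neg (mt heq.1 h')]

/-! ### Voronoi circles of families of sites -/

theorem DiscoveredCCW.rotate {S₁ S₂ S₃ : VSite} {p₁ p₂ p₃ : EPlane}
    (h : DiscoveredCCW S₁ S₂ S₃ p₁ p₂ p₃) : DiscoveredCCW S₂ S₃ S₁ p₂ p₃ p₁ := by
  rcases h with h | ⟨h, h'⟩ | ⟨h, h'⟩ | ⟨h, h'⟩
  · exact .inl (by rwa [orient_rotate])
  · exact .inr (.inr (.inr ⟨h, by rwa [orient_rotate]⟩))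
  · exact .inr (.inl ⟨h, by rwa [orient_rotate]⟩)
  · exact .inr (.inr (.inl ⟨h, by rwa [orient_rotate]⟩))

/-- Contacts and sites on a common axis-parallel line have no cyclic order. -/
theorem not_discoveredCCW_of_collinear {S₁ S₂ S₃ : VSite} {p₁ p₂ p₃ : EPlane} {i j : Fin 2}
    (hij : i ≠ j) {l : ℝ} (h₁ : p₁ j = l) (h₂ : p₂ j = l) (h₃ : p₃ j = l) (h₄ : S₁.rep j = l)
    (h₅ : S₂.rep j = l) (h₆ : S₃.rep j = l) : ¬DiscoveredCCW S₁ S₂ S₃ p₁ p₂ p₃ := by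
  have key : ∀ p q r : EPlane, p j = l → q j = l → r j = l → ¬0 < orient p q r := by
    intro p q r hp hq hr
    rw [orient_eq hij, hp, hq, hr]
    simp
  rintro (h | ⟨-, h⟩ | ⟨-, h⟩ | ⟨-, h⟩)
  exacts [key _ _ _ h₁ h₂ h₃ h, key _ _ _ h₄ h₅ h₃ h, key _ _ _ h₁ h₅ h₆ h, key _ _ _ h₄ h₂ h₆ h]

theorem VSite.rep_ne_of_disjoint {S S' : VSite} (hS : S.kind = SiteKind.point)
    (hS' : S'.kind = SiteKind.point) (h : Disjoint S.carrier S'.carrier) : S.rep ≠ S'.rep := by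
  cases S with
  | segment C D => cases hS
  | point A =>
    cases S' with
    | segment C D => cases hS'
    | point B => exact Set.disjoint_singleton.1 h

/-- A family of triples of disjoint sites, whose coordinates are linear in the input, together with
their Voronoi circles. -/
structure VoronoiFamily {X σ : Type} (x : X → σ → ℝ) (dom : X → Prop) (S₁ S₂ S₃ : X → VSite)
    (K : X → EPlane) (ρ : X → ℝ) : Prop where
  poly₁ : ∀ e k, PolyFn x 1 (fun s => (S₁ s).coord e k)
  poly₂ : ∀ e k, PolyFn x 1 (fun s => (S₂ s).coord e k)
  poly₃ : ∀ e k, PolyFn x 1 (fun s => (S₃ s).coord e k)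
  disj₁₂ : ∀ s, dom s → Disjoint (S₁ s).carrier (S₂ s).carrier
  disj₂₃ : ∀ s, dom s → Disjoint (S₂ s).carrier (S₃ s).carrier
  disj₃₁ : ∀ s, dom s → Disjoint (S₃ s).carrier (S₁ s).carrier
  circle : ∀ s, dom s → IsVoronoiCircle (S₁ s) (S₂ s) (S₃ s) (K s) (ρ s)

section Voronoi

variable {X σ : Type} {x : X → σ → ℝ} {d e : ℕ} {dom : X → Prop} {S₁ S₂ S₃ : X → VSite}
  {K : X → EPlane} {ρ : X → ℝ} {i j : Fin 2}

theorem CircleDec.of_axes (hij : i ≠ j)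
    (h : CircleDec x d e dom (fun s => K s i) (fun s => K s j) ρ) :
    CircleDec x d e dom (fun s => K s 0) (fun s => K s 1) ρ := by
  fin_cases i <;> fin_cases j <;> simp only [Fin.zero_eta, Fin.mk_one, ne_eq,
    not_true_eq_false] at hij h
  exacts [h, h.swap]

/-- Case distinction on the direction of a segment. -/
theorem CircleDec.split_along {S : X → VSite} {u v : X → ℝ}
    (hS : ∀ e k, PolyFn x 1 (fun s => (S s).coord e k)) (hd : 1 ≤ d) (he : 1 ≤ e)
    (haxes : ∀ s, dom s → (S s).AxesAligned)
    (hkind : ∀ s, dom s → (S s).kind = SiteKind.segment)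
    (h : ∀ i, CircleDec x d e (fun s => dom s ∧ (S s).Along i) u v ρ) :
    CircleDec x d e dom u v ρ := by
  refine .split_eq ((hS 0 1).sub (hS 1 1)) hd he ?_ ?_
  · refine (h 0).restrict fun s hs => ⟨hs.1, ?_⟩
    exact ((haxes s hs.1).along (hkind s hs.1)).elim And.right fun h => absurd hs.2 h.1
  · refine (h 1).restrict fun s hs => ⟨hs.1, ?_⟩
    exact ((haxes s hs.1).along (hkind s hs.1)).elim (fun h => absurd h.1 hs.2) And.right

namespace VoronoiFamily

theorem rotate (h : VoronoiFamily x dom S₁ S₂ S₃ K ρ) : VoronoiFamily x dom S₂ S₃ S₁ K ρ where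
  poly₁ := h.poly₂
  poly₂ := h.poly₃
  poly₃ := h.poly₁
  disj₁₂ := h.disj₂₃
  disj₂₃ := h.disj₃₁
  disj₃₁ := h.disj₁₂
  circle s hs := by
    obtain ⟨hρ, p₁, p₂, p₃, h₁, h₂, h₃, h₄⟩ := h.circle s hs
    exact ⟨hρ, p₂, p₃, p₁, h₂, h₃, h₁, h₄.rotate⟩

theorem restrict (h : VoronoiFamily x dom S₁ S₂ S₃ K ρ) {dom' : X → Prop}
    (hdom : ∀ s, dom' s → dom s) : VoronoiFamily x dom' S₁ S₂ S₃ K ρ where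
  poly₁ := h.poly₁
  poly₂ := h.poly₂
  poly₃ := h.poly₃
  disj₁₂ s hs := h.disj₁₂ s (hdom s hs)
  disj₂₃ s hs := h.disj₂₃ s (hdom s hs)
  disj₃₁ s hs := h.disj₃₁ s (hdom s hs)
  circle s hs := h.circle s (hdom s hs)

/-- The circle through three points. -/
theorem circleDec_ppp (h : VoronoiFamily x dom S₁ S₂ S₃ K ρ)
    (h₁ : ∀ s, dom s → (S₁ s).kind = SiteKind.point)
    (h₂ : ∀ s, dom s → (S₂ s).kind = SiteKind.point)
    (h₃ : ∀ s, dom s → (S₃ s).kind = SiteKind.point) :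
    CircleDec x 4 6 dom (fun s => K s 0) (fun s => K s 1) ρ := by
  have facts : ∀ s, dom s →
      ((S₁ s).coord 0 0 - K s 0) ^ 2 + ((S₁ s).coord 0 1 - K s 1) ^ 2 = ρ s ^ 2 ∧
      ((S₂ s).coord 0 0 - K s 0) ^ 2 + ((S₂ s).coord 0 1 - K s 1) ^ 2 = ρ s ^ 2 ∧
      ((S₃ s).coord 0 0 - K s 0) ^ 2 + ((S₃ s).coord 0 1 - K s 1) ^ 2 = ρ s ^ 2 ∧
      0 < ((S₂ s).coord 0 0 - (S₁ s).coord 0 0) * ((S₃ s).coord 0 1 - (S₁ s).coord 0 1) -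
        ((S₂ s).coord 0 1 - (S₁ s).coord 0 1) * ((S₃ s).coord 0 0 - (S₁ s).coord 0 0) := by
    intro s hs
    obtain ⟨-, p₁, p₂, p₃, hp₁, hp₂, hp₃, hccw⟩ := h.circle s hs
    obtain ⟨hr₁, hc₁, hd₁⟩ := hp₁.of_point (h₁ s hs)
    obtain ⟨hr₂, hc₂, hd₂⟩ := hp₂.of_point (h₂ s hs)
    obtain ⟨hr₃, hc₃, hd₃⟩ := hp₃.of_point (h₃ s hs)
    rw [dist_sq_eq (i := 0) (j := 1) (by decide)] at hd₁ hd₂ hd₃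
    simp only [← hc₁, ← hc₂, ← hc₃]
    refine ⟨hd₁, hd₂, hd₃, ?_⟩
    rcases hccw with h' | ⟨h', -⟩ | ⟨h', -⟩ | ⟨h', -⟩
    · exact h'
    · exact absurd (hr₁ ▸ hr₂ ▸ h') (VSite.rep_ne_of_disjoint (h₁ s hs) (h₂ s hs) (h.disj₁₂ s hs))
    · exact absurd (hr₂ ▸ hr₃ ▸ h') (VSite.rep_ne_of_disjoint (h₂ s hs) (h₃ s hs) (h.disj₂₃ s hs))
    · exact absurd (hr₃ ▸ hr₁ ▸ h') (VSite.rep_ne_of_disjoint (h₃ s hs) (h₁ s hs) (h.disj₃₁ s hs))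
  refine .translate (h.poly₁ 0 0) (h.poly₁ 0 1)
    (.of_three_points ((h.poly₂ 0 0).sub (h.poly₁ 0 0)) ((h.poly₂ 0 1).sub (h.poly₁ 0 1))
      ((h.poly₃ 0 0).sub (h.poly₁ 0 0)) ((h.poly₃ 0 1).sub (h.poly₁ 0 1))
      (fun s hs => ?_) (fun s hs => ?_) (fun s hs => ?_) (fun s hs => (facts s hs).2.2.2.ne'))
  · rw [← (facts s hs).1]
    ring
  · rw [← (facts s hs).2.1]
    ring
  · rw [← (facts s hs).2.2.1]
    ring

/-- The circles through two points that are tangent to a segment in a given direction. -/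
theorem circleDec_pps_along (h : VoronoiFamily x dom S₁ S₂ S₃ K ρ) (hij : i ≠ j)
    (h₁ : ∀ s, dom s → (S₁ s).kind = SiteKind.point)
    (h₂ : ∀ s, dom s → (S₂ s).kind = SiteKind.point)
    (h₃ : ∀ s, dom s → (S₃ s).Along i) :
    CircleDec x 6 6 dom (fun s => K s 0) (fun s => K s 1) ρ := by
  have facts : ∀ s, dom s →
      ((S₁ s).coord 0 i - K s i) ^ 2 + ((S₁ s).coord 0 j - K s j) ^ 2 = ρ s ^ 2 ∧
      ((S₂ s).coord 0 i - K s i) ^ 2 + ((S₂ s).coord 0 j - K s j) ^ 2 = ρ s ^ 2 ∧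
      (K s j - (S₃ s).coord 0 j) ^ 2 = ρ s ^ 2 ∧
      0 ≤ axisSign i * (((S₂ s).coord 0 i - (S₁ s).coord 0 i) *
          ((S₃ s).coord 0 j - (S₁ s).coord 0 j) -
        ((S₂ s).coord 0 j - (S₁ s).coord 0 j) * (K s i - (S₁ s).coord 0 i)) ∧
      ((S₂ s).coord 0 j = (S₁ s).coord 0 j → (S₂ s).coord 0 i ≠ (S₁ s).coord 0 i) := by
    intro s hs
    obtain ⟨-, p₁, p₂, p₃, hp₁, hp₂, hp₃, hccw⟩ := h.circle s hs
    obtain ⟨hr₁, hc₁, hd₁⟩ := hp₁.of_point (h₁ s hs)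
    obtain ⟨hr₂, hc₂, hd₂⟩ := hp₂.of_point (h₂ s hs)
    obtain ⟨hi₃, hj₃, hd₃, -⟩ := (h₃ s hs).touchedAt hij hp₃
    rw [dist_sq_eq hij] at hd₁ hd₂
    have hne : p₁ ≠ p₂ := by
      rw [hr₁, hr₂]
      exact VSite.rep_ne_of_disjoint (h₁ s hs) (h₂ s hs) (h.disj₁₂ s hs)
    simp only [← hc₁, ← hc₂]
    refine ⟨hd₁, hd₂, hd₃, ?_, fun h₁ h₂ => hne ?_⟩
    · rw [← hi₃, ← hj₃, ← orient_eq hij]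
      rcases hccw with h' | ⟨h', -⟩ | ⟨h', -⟩ | ⟨h', -⟩
      · exact h'.le
      · exact absurd h' hne
      · rw [h', orient_eq hij]
        exact le_of_eq (by ring)
      · rw [h', orient_eq hij]
        exact le_of_eq (by ring)
    · ext k
      rcases Fin.eq_or_eq_of_ne hij k with rfl | rfl
      exacts [h₂.symm, h₁.symm]
  refine .of_axes hij (.translate PolyFn.zero (h.poly₃ 0 j) (.congr_radius
    (.of_two_points_tangent (axisSign i) (axisSign_sq i) (h.poly₁ 0 i)
      ((h.poly₁ 0 j).sub (h.poly₃ 0 j)) (h.poly₂ 0 i) ((h.poly₂ 0 j).sub (h.poly₃ 0 j))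
      (fun s hs => ?_) (fun s hs => ?_) (fun s hs => ?_) (fun s hs h' => ?_))
    fun s hs => (facts s hs).2.2.1))
  · rw [(facts s hs).2.2.1, ← (facts s hs).1]
    ring
  · rw [(facts s hs).2.2.1, ← (facts s hs).2.1]
    ring
  · exact (facts s hs).2.2.2.1.trans_eq (by ring)
  · exact (facts s hs).2.2.2.2 (by linarith)

theorem circleDec_pps (h : VoronoiFamily x dom S₁ S₂ S₃ K ρ)
    (h₁ : ∀ s, dom s → (S₁ s).kind = SiteKind.point)
    (h₂ : ∀ s, dom s → (S₂ s).kind = SiteKind.point)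
    (h₃ : ∀ s, dom s → (S₃ s).kind = SiteKind.segment)
    (haxes : ∀ s, dom s → (S₃ s).AxesAligned) :
    CircleDec x 6 6 dom (fun s => K s 0) (fun s => K s 1) ρ :=
  .split_along h.poly₃ (by norm_num) (by norm_num) haxes h₃ fun i =>
    circleDec_pps_along (j := i + 1) (h.restrict fun _ hs => hs.1) (by fin_cases i <;> decide)
      (fun s hs => h₁ s hs.1) (fun s hs => h₂ s hs.1) fun _ hs => hs.2

/-- The circles through a point that are tangent to two perpendicular segments. -/
theorem circleDec_pss_perpendicular (h : VoronoiFamily x dom S₁ S₂ S₃ K ρ) (hij : i ≠ j)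
    (h₁ : ∀ s, dom s → (S₁ s).kind = SiteKind.point)
    (h₂ : ∀ s, dom s → (S₂ s).Along i) (h₃ : ∀ s, dom s → (S₃ s).Along j) :
    CircleDec x 4 2 dom (fun s => K s 0) (fun s => K s 1) ρ := by
  have facts : ∀ s, dom s → 0 < ρ s ∧ (K s i - (S₃ s).coord 0 i) ^ 2 = ρ s ^ 2 ∧
      (K s j - (S₂ s).coord 0 j) ^ 2 = ρ s ^ 2 ∧
      ((S₁ s).coord 0 i - K s i) ^ 2 + ((S₁ s).coord 0 j - K s j) ^ 2 = ρ s ^ 2 ∧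
      (0 < axisSign i * ((K s i - (S₁ s).coord 0 i) * (K s j - (S₁ s).coord 0 j) -
          ((S₂ s).coord 0 j - (S₁ s).coord 0 j) * ((S₃ s).coord 0 i - (S₁ s).coord 0 i)) ∨
        ((S₁ s).coord 0 j = (S₂ s).coord 0 j ∧ (S₁ s).coord 0 i = K s i ∧
          0 < axisSign i * (((S₂ s).rep i - (S₁ s).coord 0 i) *
            (K s j - (S₂ s).coord 0 j))) ∨
        ((S₁ s).coord 0 i = (S₃ s).coord 0 i ∧ (S₁ s).coord 0 j = K s j ∧
          0 < axisSign i * (((S₃ s).rep j - (S₁ s).coord 0 j) *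
            (K s i - (S₃ s).coord 0 i)))) := by
    intro s hs
    obtain ⟨hρ, p₁, p₂, p₃, hp₁, hp₂, hp₃, hccw⟩ := h.circle s hs
    obtain ⟨hr₁, hc₁, hd₁⟩ := hp₁.of_point (h₁ s hs)
    obtain ⟨hi₂, hj₂, hd₂, -⟩ := (h₂ s hs).touchedAt hij hp₂
    obtain ⟨hj₃, hi₃, hd₃, -⟩ := (h₃ s hs).touchedAt hij.symm hp₃
    rw [dist_sq_eq hij] at hd₁
    refine ⟨hρ, hd₃, hd₂, by rwa [← hc₁, ← hc₁], ?_⟩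
    simp only [← hc₁]
    rcases hccw with h' | ⟨h', h''⟩ | ⟨h', h''⟩ | ⟨h', h''⟩
    · left
      rwa [orient_eq hij, hi₂, hj₂, hi₃, hj₃] at h'
    · refine .inr (.inl ⟨by rw [h', hj₂], by rw [h', hi₂], ?_⟩)
      rw [← hr₁, orient_eq hij, ((h₂ s hs).rep hij).2, h', hi₂, hj₂, hi₃, hj₃] at h''
      rw [h', hi₂]
      exact h''.trans_eq (by ring)
    · rw [← hi₃, ← h', hi₂, sub_self] at hd₃
      nlinarith
    · refine .inr (.inr ⟨by rw [← h', hi₃], by rw [← h', hj₃], ?_⟩)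
      rw [← hr₁, orient_eq hij, ((h₃ s hs).rep hij.symm).2, ← h', hi₂, hj₂, hi₃, hj₃] at h''
      rw [← h', hj₃]
      exact h''.trans_eq (by ring)
  refine .of_axes hij (.translate (h.poly₃ 0 i) (h.poly₂ 0 j)
    (.of_point_tangent_axes (axisSign i) (axisSign_sq i)
      ((h.poly₁ 0 i).sub (h.poly₃ 0 i)) ((h.poly₁ 0 j).sub (h.poly₂ 0 j))
      (((h.poly₂ 0 i).add (h.poly₂ 1 i)).sub ((h.poly₁ 0 i).ofNat_mul 2))
      (((h.poly₃ 0 j).add (h.poly₃ 1 j)).sub ((h.poly₁ 0 j).ofNat_mul 2))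
      (fun s hs => (facts s hs).1) (fun s hs => (facts s hs).2.1)
      (fun s hs => (facts s hs).2.2.1) (fun s hs => ?_) (fun s hs => ?_)))
  · rw [← (facts s hs).2.2.2.1]
    ring
  · rcases (facts s hs).2.2.2.2 with h' | ⟨h', h'', h'''⟩ | ⟨h', h'', h'''⟩
    · exact .inl (h'.trans_eq (by ring))
    · refine .inr (.inl ⟨by rw [h', sub_self], by rw [h''], ?_⟩)
      rw [← ((h₂ s hs).rep hij).1]
      exact (mul_pos two_pos h''').trans_eq (by ring)
    · refine .inr (.inr ⟨by rw [h', sub_self], by rw [h''], ?_⟩)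
      rw [← ((h₃ s hs).rep hij.symm).1]
      exact (mul_pos two_pos h''').trans_eq (by ring)

/-- If the second and the third site are collinear segments, then the contact with them is one of
finitely many endpoints, found by comparing coordinates. -/
theorem split_common (h : VoronoiFamily x dom S₁ S₂ S₃ K ρ) (hij : i ≠ j) (hd : 1 ≤ d)
    (he : 1 ≤ e) (h₂ : ∀ s, dom s → (S₂ s).Along i) (h₃ : ∀ s, dom s → (S₃ s).Along i)
    (hj : ∀ s, dom s → (S₂ s).coord 0 j = (S₃ s).coord 0 j) {u v : X → ℝ}
    (H : ∀ t dom', PolyFn x 1 t → (∀ s, dom' s → dom s) → (∀ s, dom' s → K s i = t s) →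
      CircleDec x d e dom' u v ρ) : CircleDec x d e dom u v ρ := by
  have facts : ∀ s, dom s →
      (((S₂ s).coord 0 i - (S₃ s).coord 0 i = 0 ∨ (S₂ s).coord 0 i - (S₃ s).coord 1 i = 0) ∧
        K s i = (S₂ s).coord 0 i) ∨
      ((S₂ s).coord 0 i - (S₃ s).coord 0 i ≠ 0 ∧ (S₂ s).coord 0 i - (S₃ s).coord 1 i ≠ 0 ∧
        K s i = (S₂ s).coord 1 i) := fun s hs => by
    obtain ⟨-, p₁, p₂, p₃, -, hp₂, hp₃, -⟩ := h.circle s hs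
    exact (h₂ s hs).touch_common (h₃ s hs) hij (hj s hs) (h.disj₂₃ s hs)
      ((h₂ s hs).touchedAt hij hp₂).2.2.2 ((h₃ s hs).touchedAt hij hp₃).2.2.2
  refine .split_eq ((h.poly₂ 0 i).sub (h.poly₃ 0 i)) hd he ?_
    (.split_eq ((h.poly₂ 0 i).sub (h.poly₃ 1 i)) hd he ?_ ?_)
  · refine H _ _ (h.poly₂ 0 i) (fun s hs => hs.1) fun s hs => ?_
    exact (facts s hs.1).elim And.right fun h' => absurd hs.2 h'.1
  · refine H _ _ (h.poly₂ 0 i) (fun s hs => hs.1.1) fun s hs => ?_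
    exact (facts s hs.1.1).elim And.right fun h' => absurd hs.2 h'.2.1
  · refine H _ _ (h.poly₂ 1 i) (fun s hs => hs.1.1) fun s hs => ?_
    exact (facts s hs.1.1).elim
      (fun h' => h'.1.elim (fun h₀ => absurd h₀ hs.1.2) fun h₀ => absurd h₀ hs.2)
      fun h' => h'.2.2

/-- The circles through a point that are tangent to two parallel segments. -/
theorem circleDec_pss_parallel (h : VoronoiFamily x dom S₁ S₂ S₃ K ρ) (hij : i ≠ j)
    (h₁ : ∀ s, dom s → (S₁ s).kind = SiteKind.point)
    (h₂ : ∀ s, dom s → (S₂ s).Along i) (h₃ : ∀ s, dom s → (S₃ s).Along i) :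
    CircleDec x 4 2 dom (fun s => K s 0) (fun s => K s 1) ρ := by
  have facts : ∀ s, dom s → (K s j - (S₂ s).coord 0 j) ^ 2 = ρ s ^ 2 ∧
      (K s j - (S₃ s).coord 0 j) ^ 2 = ρ s ^ 2 ∧
      ((S₁ s).coord 0 i - K s i) ^ 2 + ((S₁ s).coord 0 j - K s j) ^ 2 = ρ s ^ 2 ∧
      ((S₃ s).coord 0 j - (S₂ s).coord 0 j = 0 → (S₁ s).coord 0 j - (S₂ s).coord 0 j ≠ 0) ∧
      ((S₃ s).coord 0 j - (S₂ s).coord 0 j ≠ 0 → 0 ≤ axisSign i *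
        (((S₃ s).coord 0 j - (S₂ s).coord 0 j) * (K s i - (S₁ s).coord 0 i))) := by
    intro s hs
    obtain ⟨-, p₁, p₂, p₃, hp₁, hp₂, hp₃, hccw⟩ := h.circle s hs
    obtain ⟨hr₁, hc₁, hd₁⟩ := hp₁.of_point (h₁ s hs)
    obtain ⟨hi₂, hj₂, hd₂, -⟩ := (h₂ s hs).touchedAt hij hp₂
    obtain ⟨hi₃, hj₃, hd₃, -⟩ := (h₃ s hs).touchedAt hij hp₃
    rw [dist_sq_eq hij] at hd₁
    simp only [← hc₁]
    refine ⟨hd₂, hd₃, hd₁, fun h' h'' => ?_, fun hne => ?_⟩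
    · refine not_discoveredCCW_of_collinear hij (l := (S₂ s).coord 0 j) (sub_eq_zero.1 h'') hj₂
        (hj₃.trans (sub_eq_zero.1 h')) ?_ ((h₂ s hs).rep hij).2
        (((h₃ s hs).rep hij).2.trans (sub_eq_zero.1 h')) hccw
      rw [← hr₁]
      exact sub_eq_zero.1 h''
    · rcases hccw with h' | ⟨h', -⟩ | ⟨h', -⟩ | ⟨h', -⟩
      · rw [orient_eq hij, hi₂, hj₂, hi₃, hj₃] at h'
        exact h'.le.trans_eq (by ring)
      · rw [h', hi₂, sub_self, mul_zero, mul_zero]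
      · refine absurd ?_ hne
        rw [← hj₂, ← hj₃, h', sub_self]
      · rw [← h', hi₃, sub_self, mul_zero, mul_zero]
  refine .split_eq ((h.poly₃ 0 j).sub (h.poly₂ 0 j)) (by norm_num) (by norm_num) ?_ ?_
  · refine split_common (h.restrict fun _ hs => hs.1) hij (by norm_num) (by norm_num)
      (fun s hs => h₂ s hs.1) (fun s hs => h₃ s hs.1)
      (fun s hs => (sub_eq_zero.1 hs.2).symm) fun t dom' ht hdom hKt => ?_
    refine .of_axes hij (.translate PolyFn.zero (h.poly₂ 0 j)
      (.of_point_tangent_at (h.poly₁ 0 i) ((h.poly₁ 0 j).sub (h.poly₂ 0 j)) ht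
        (fun s hs => (facts s (hdom s hs).1).2.2.2.1 (hdom s hs).2)
        (fun s hs => (facts s (hdom s hs).1).1) (fun s hs => ?_)
        (fun s hs => by rw [hKt s hs, sub_zero])))
    rw [← (facts s (hdom s hs).1).2.2.1]
    ring
  · refine .of_axes hij (.translate PolyFn.zero (h.poly₂ 0 j)
      (.of_point_tangent_parallel (axisSign i) (axisSign_sq i) (h.poly₁ 0 i)
        ((h.poly₁ 0 j).sub (h.poly₂ 0 j)) ((h.poly₃ 0 j).sub (h.poly₂ 0 j))
        (fun s hs => hs.2) (fun s hs => (facts s hs.1).1) (fun s hs => ?_) (fun s hs => ?_)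
        (fun s hs => ?_)))
    · rw [← (facts s hs.1).2.1]
      ring
    · rw [← (facts s hs.1).2.2.1]
      ring
    · rw [sub_zero]
      exact (facts s hs.1).2.2.2.2 hs.2

theorem circleDec_pss (h : VoronoiFamily x dom S₁ S₂ S₃ K ρ)
    (h₁ : ∀ s, dom s → (S₁ s).kind = SiteKind.point)
    (h₂ : ∀ s, dom s → (S₂ s).kind = SiteKind.segment)
    (h₃ : ∀ s, dom s → (S₃ s).kind = SiteKind.segment)
    (haxes₂ : ∀ s, dom s → (S₂ s).AxesAligned) (haxes₃ : ∀ s, dom s → (S₃ s).AxesAligned) :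
    CircleDec x 4 2 dom (fun s => K s 0) (fun s => K s 1) ρ := by
  refine .split_along h.poly₂ (by norm_num) (by norm_num) haxes₂ h₂ fun i =>
    .split_along h.poly₃ (by norm_num) (by norm_num) (fun s hs => haxes₃ s hs.1)
      (fun s hs => h₃ s hs.1) fun j => ?_
  have h' := h.restrict (dom' := fun s => (dom s ∧ (S₂ s).Along i) ∧ (S₃ s).Along j)
    fun _ hs => hs.1.1
  by_cases hij : i = j
  · subst hij
    exact h'.circleDec_pss_parallel (j := i + 1) (by fin_cases i <;> decide)
      (fun s hs => h₁ s hs.1.1) (fun _ hs => hs.1.2) fun _ hs => hs.2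
  · exact h'.circleDec_pss_perpendicular hij (fun s hs => h₁ s hs.1.1) (fun _ hs => hs.1.2)
      fun _ hs => hs.2

/-- The circles that are tangent to two collinear segments and to a third, parallel segment. -/
theorem circleDec_sss_collinear (h : VoronoiFamily x dom S₁ S₂ S₃ K ρ) (hij : i ≠ j)
    (h₁ : ∀ s, dom s → (S₁ s).Along i) (h₂ : ∀ s, dom s → (S₂ s).Along i)
    (h₃ : ∀ s, dom s → (S₃ s).Along i)
    (hj : ∀ s, dom s → (S₂ s).coord 0 j - (S₃ s).coord 0 j = 0) :
    CircleDec x 2 1 dom (fun s => K s 0) (fun s => K s 1) ρ := by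
  refine split_common h hij (by norm_num) le_rfl h₂ h₃
    (fun s hs => sub_eq_zero.1 (hj s hs)) fun t dom' ht hdom hKt => ?_
  have facts : ∀ s, dom s → (K s j - (S₂ s).coord 0 j) ^ 2 = ρ s ^ 2 ∧
      (K s j - (S₁ s).coord 0 j) ^ 2 = ρ s ^ 2 ∧
      (S₁ s).coord 0 j - (S₂ s).coord 0 j ≠ 0 := by
    intro s hs
    obtain ⟨-, p₁, p₂, p₃, hp₁, hp₂, hp₃, hccw⟩ := h.circle s hs
    obtain ⟨hi₁, hj₁, hd₁, -⟩ := (h₁ s hs).touchedAt hij hp₁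
    obtain ⟨hi₂, hj₂, hd₂, -⟩ := (h₂ s hs).touchedAt hij hp₂
    obtain ⟨hi₃, hj₃, hd₃, -⟩ := (h₃ s hs).touchedAt hij hp₃
    have hj := (sub_eq_zero.1 (hj s hs)).symm
    refine ⟨hd₂, hd₁, fun h' => ?_⟩
    have h' := sub_eq_zero.1 h'
    exact not_discoveredCCW_of_collinear hij (hj₁.trans h') hj₂ (hj₃.trans hj)
      (((h₁ s hs).rep hij).2.trans h') ((h₂ s hs).rep hij).2 (((h₃ s hs).rep hij).2.trans hj) hccw
  refine .of_axes hij (.translate PolyFn.zero (h.poly₂ 0 j)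
    (.of_tangent_at_parallel ((h.poly₁ 0 j).sub (h.poly₂ 0 j)) ht
      (fun s hs => (facts s (hdom s hs)).2.2) (fun s hs => (facts s (hdom s hs)).1)
      (fun s hs => ?_) (fun s hs => by rw [hKt s hs, sub_zero])))
  rw [← (facts s (hdom s hs)).2.1]
  ring

/-- The circles that are tangent to three parallel segments, two of which have to be collinear. -/
theorem circleDec_sss_parallel (h : VoronoiFamily x dom S₁ S₂ S₃ K ρ) (hij : i ≠ j)
    (h₁ : ∀ s, dom s → (S₁ s).Along i) (h₂ : ∀ s, dom s → (S₂ s).Along i)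
    (h₃ : ∀ s, dom s → (S₃ s).Along i) :
    CircleDec x 2 1 dom (fun s => K s 0) (fun s => K s 1) ρ := by
  refine .split_eq ((h.poly₂ 0 j).sub (h.poly₃ 0 j)) (by norm_num) le_rfl
    ((h.restrict fun _ hs => hs.1).circleDec_sss_collinear hij (fun s hs => h₁ s hs.1)
      (fun s hs => h₂ s hs.1) (fun s hs => h₃ s hs.1) fun _ hs => hs.2)
    (.split_eq ((h.poly₃ 0 j).sub (h.poly₁ 0 j)) (by norm_num) le_rfl
      ((h.rotate.restrict fun _ hs => hs.1.1).circleDec_sss_collinear hij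
        (fun s hs => h₂ s hs.1.1) (fun s hs => h₃ s hs.1.1) (fun s hs => h₁ s hs.1.1)
        fun _ hs => hs.2)
      ((h.rotate.rotate.restrict fun _ hs => hs.1.1).circleDec_sss_collinear hij
        (fun s hs => h₃ s hs.1.1) (fun s hs => h₁ s hs.1.1) (fun s hs => h₂ s hs.1.1)
        fun s hs => ?_))
  -- All three lines have the same distance from the centre, so two of them coincide.
  obtain ⟨-, p₁, p₂, p₃, hp₁, hp₂, hp₃, -⟩ := h.circle s hs.1.1
  have hd₁ := ((h₁ s hs.1.1).touchedAt hij hp₁).2.2.1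
  have hd₂ := ((h₂ s hs.1.1).touchedAt hij hp₂).2.2.1
  have hd₃ := ((h₃ s hs.1.1).touchedAt hij hp₃).2.2.1
  have h₁₃ : 2 * K s j - (S₁ s).coord 0 j - (S₃ s).coord 0 j = 0 :=
    mul_left_cancel₀ hs.2 (by linear_combination hd₁ - hd₃)
  have h₂₃ : 2 * K s j - (S₂ s).coord 0 j - (S₃ s).coord 0 j = 0 :=
    mul_left_cancel₀ hs.1.2 (by linear_combination hd₃ - hd₂)
  linarith

/-- The circles that are tangent to two parallel segments and to a perpendicular one. -/
theorem circleDec_sss_perpendicular (h : VoronoiFamily x dom S₁ S₂ S₃ K ρ) (hij : i ≠ j)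
    (h₁ : ∀ s, dom s → (S₁ s).Along j) (h₂ : ∀ s, dom s → (S₂ s).Along i)
    (h₃ : ∀ s, dom s → (S₃ s).Along i) :
    CircleDec x 2 1 dom (fun s => K s 0) (fun s => K s 1) ρ := by
  have facts : ∀ s, dom s → 0 < ρ s ∧ (K s i - (S₁ s).coord 0 i) ^ 2 = ρ s ^ 2 ∧
      (K s j - (S₂ s).coord 0 j) ^ 2 = ρ s ^ 2 ∧ (K s j - (S₃ s).coord 0 j) ^ 2 = ρ s ^ 2 ∧
      (0 < axisSign i * (((S₃ s).coord 0 j - (S₂ s).coord 0 j) * (K s i - (S₁ s).coord 0 i)) ∨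
        (S₃ s).coord 0 j - (S₂ s).coord 0 j = 0 ∧
          0 < axisSign i * (((S₃ s).rep i - (S₂ s).rep i) * (K s j - (S₂ s).coord 0 j))) := by
    intro s hs
    obtain ⟨hρ, p₁, p₂, p₃, hp₁, hp₂, hp₃, hccw⟩ := h.circle s hs
    obtain ⟨hj₁, hi₁, hd₁, -⟩ := (h₁ s hs).touchedAt hij.symm hp₁
    obtain ⟨hi₂, hj₂, hd₂, -⟩ := (h₂ s hs).touchedAt hij hp₂
    obtain ⟨hi₃, hj₃, hd₃, -⟩ := (h₃ s hs).touchedAt hij hp₃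
    have hne : K s i ≠ (S₁ s).coord 0 i := fun h' => by
      rw [h', sub_self] at hd₁
      nlinarith
    refine ⟨hρ, hd₁, hd₂, hd₃, ?_⟩
    rcases hccw with h' | ⟨h', -⟩ | ⟨h', h''⟩ | ⟨h', -⟩
    · left
      rw [orient_eq hij, hi₁, hj₁, hi₂, hj₂, hi₃, hj₃] at h'
      exact h'.trans_eq (by ring)
    · exact absurd (by rw [← hi₁, ← hi₂, h']) hne
    · have hl : (S₃ s).coord 0 j = (S₂ s).coord 0 j := by rw [← hj₂, ← hj₃, h']
      refine .inr ⟨sub_eq_zero.2 hl, ?_⟩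
      rw [orient_eq hij, hi₁, hj₁, ((h₂ s hs).rep hij).2, ((h₃ s hs).rep hij).2, hl] at h''
      exact h''.trans_eq (by ring)
    · exact absurd (by rw [← hi₁, ← hi₃, h']) hne
  refine .split_eq ((h.poly₃ 0 j).sub (h.poly₂ 0 j)) (by norm_num) le_rfl ?_ ?_
  · refine split_common (h.restrict fun _ hs => hs.1) hij (by norm_num) le_rfl
      (fun s hs => h₂ s hs.1) (fun s hs => h₃ s hs.1)
      (fun s hs => (sub_eq_zero.1 hs.2).symm) fun t dom' ht hdom hKt => ?_
    refine .of_axes hij (.translate (h.poly₁ 0 i) (h.poly₂ 0 j)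
      (.of_tangent_at_perpendicular
        ((((h.poly₃ 0 i).add (h.poly₃ 1 i)).sub
          ((h.poly₂ 0 i).add (h.poly₂ 1 i))).intCast_mul (axisSign i))
        (ht.sub (h.poly₁ 0 i)) (fun s hs => (facts s (hdom s hs).1).1)
        (fun s hs => (facts s (hdom s hs).1).2.1) (fun s hs => (facts s (hdom s hs).1).2.2.1)
        (fun s hs => by rw [hKt s hs]) (fun s hs => ?_)))
    obtain ⟨hs, hs'⟩ := hdom s hs
    rcases (facts s hs).2.2.2.2 with h' | h'
    · rw [hs', zero_mul, mul_zero] at h'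
      exact absurd h' (lt_irrefl _)
    · rw [← ((h₂ s hs).rep hij).1, ← ((h₃ s hs).rep hij).1]
      exact (mul_pos two_pos h'.2).trans_eq (by ring)
  · refine .of_axes hij (.translate (h.poly₁ 0 i) (h.poly₂ 0 j)
      (.of_tangent_parallel_perpendicular (axisSign i) (axisSign_sq i)
        ((h.poly₃ 0 j).sub (h.poly₂ 0 j)) (fun s hs => hs.2)
        (fun s hs => (facts s hs.1).2.1) (fun s hs => (facts s hs.1).2.2.1) (fun s hs => ?_)
        (fun s hs => (facts s hs.1).2.2.2.2.resolve_right fun h' => hs.2 h'.1)))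
    rw [← (facts s hs.1).2.2.2.1]
    ring

theorem circleDec_sss (h : VoronoiFamily x dom S₁ S₂ S₃ K ρ)
    (h₁ : ∀ s, dom s → (S₁ s).kind = SiteKind.segment)
    (h₂ : ∀ s, dom s → (S₂ s).kind = SiteKind.segment)
    (h₃ : ∀ s, dom s → (S₃ s).kind = SiteKind.segment)
    (haxes₁ : ∀ s, dom s → (S₁ s).AxesAligned) (haxes₂ : ∀ s, dom s → (S₂ s).AxesAligned)
    (haxes₃ : ∀ s, dom s → (S₃ s).AxesAligned) :
    CircleDec x 2 1 dom (fun s => K s 0) (fun s => K s 1) ρ := by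
  refine .split_along h.poly₁ (by norm_num) le_rfl haxes₁ h₁ fun i =>
    .split_along h.poly₂ (by norm_num) le_rfl (fun s hs => haxes₂ s hs.1)
      (fun s hs => h₂ s hs.1) fun j =>
    .split_along h.poly₃ (by norm_num) le_rfl (fun s hs => haxes₃ s hs.1.1)
      (fun s hs => h₃ s hs.1.1) fun k => ?_
  have h' := h.restrict
    (dom' := fun s => ((dom s ∧ (S₁ s).Along i) ∧ (S₂ s).Along j) ∧ (S₃ s).Along k)
    fun _ hs => hs.1.1.1
  by_cases hij : i = j
  · subst hij
    by_cases hik : i = k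
    · subst hik
      exact h'.circleDec_sss_parallel (j := i + 1) (by fin_cases i <;> decide)
        (fun _ hs => hs.1.1.2) (fun _ hs => hs.1.2) fun _ hs => hs.2
    · exact h'.rotate.rotate.circleDec_sss_perpendicular hik (fun _ hs => hs.2)
        (fun _ hs => hs.1.1.2) fun _ hs => hs.1.2
  · rcases Fin.eq_or_eq_of_ne hij k with rfl | rfl
    · exact h'.rotate.circleDec_sss_perpendicular hij (fun _ hs => hs.1.2) (fun _ hs => hs.2)
        fun _ hs => hs.1.1.2
    · exact h'.circleDec_sss_perpendicular (Ne.symm hij) (fun _ hs => hs.1.1.2)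
        (fun _ hs => hs.1.2) fun _ hs => hs.2

end VoronoiFamily

end Voronoi

/-! ### The degree bounds -/

section Predicate

variable {X σ : Type} {x : X → σ → ℝ} {d e : ℕ} {dom : X → Prop} {K : X → EPlane} {ρ : X → ℝ}
  {O : X → VSite}

theorem CircleDec.incircle_point (h : CircleDec x d e dom (fun s => K s 0) (fun s => K s 1) ρ)
    (hρ : ∀ s, dom s → 0 < ρ s) (hO : ∀ e k, PolyFn x 1 (fun s => (O s).coord e k))
    (hkind : ∀ s, dom s → (O s).kind = SiteKind.point) :
    SignDec x d dom (fun s => incircleValue (K s) (ρ s) (O s)) :=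
  (h.point _ _ (hO 0 0) (hO 0 1)).congr fun s hs =>
    (incircleValue_point (hkind s hs) (K s) (hρ s hs)).symm

theorem CircleDec.incircle_along {i j : Fin 2} (hij : i ≠ j)
    (h : CircleDec x d e dom (fun s => K s i) (fun s => K s j) ρ)
    (hde : d ≤ e) (hρ : ∀ s, dom s → 0 < ρ s)
    (hO : ∀ e k, PolyFn x 1 (fun s => (O s).coord e k)) (halong : ∀ s, dom s → (O s).Along i) :
    SignDec x e dom (fun s => incircleValue (K s) (ρ s) (O s)) := by
  have h₀ := (h.point _ _ (hO 0 i) (hO 0 j)).mono hde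
  have h₁ := (h.point _ _ (hO 1 i) (hO 0 j)).mono hde
  have h₂ := (h.line.fstCoord _ (hO 0 i)).sign_mul (h.line.fstCoord _ (hO 1 i))
  have h₃ := h.line.sndLine _ (hO 0 j)
  refine h₀.bind fun a => (h₁.restrict fun _ hs => hs.1).bind fun b =>
    (SignDec.map₂ (segmentValue a b) (h₂.restrict fun _ hs => hs.1.1)
      (h₃.restrict fun _ hs => hs.1.1)).congr fun s hs => ?_
  rw [(halong s hs.1.1).incircleValue_eq hij (K s) (hρ s hs.1.1), hs.1.2, hs.2]

theorem CircleDec.incircle_segment (h : CircleDec x d e dom (fun s => K s 0) (fun s => K s 1) ρ)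
    (hde : d ≤ e) (he : 1 ≤ e) (hρ : ∀ s, dom s → 0 < ρ s)
    (hO : ∀ e k, PolyFn x 1 (fun s => (O s).coord e k))
    (haxes : ∀ s, dom s → (O s).AxesAligned)
    (hkind : ∀ s, dom s → (O s).kind = SiteKind.segment) :
    SignDec x e dom (fun s => incircleValue (K s) (ρ s) (O s)) := by
  have key := fun i j (hij : i ≠ j)
      (h : CircleDec x d e dom (fun s => K s i) (fun s => K s j) ρ) =>
    incircle_along (dom := fun s => dom s ∧ (O s).Along i) hij (h.restrict fun _ hs => hs.1) hde
      (fun s hs => hρ s hs.1) hO fun _ hs => hs.2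
  have h₀ := key 0 1 (by decide) h
  have h₁ := key 1 0 (by decide) h.swap
  have hdir := fun s (hs : dom s) => (haxes s hs).along (hkind s hs)
  exact .split ((hO 0 1).sub (hO 1 1)) he
    (h₁.restrict fun s hs => ⟨hs.1, (hdir s hs.1).elim (fun h => absurd h.1 hs.2.ne) And.right⟩)
    (h₀.restrict fun s hs => ⟨hs.1, (hdir s hs.1).elim And.right fun h => absurd hs.2 h.1⟩)
    (h₁.restrict fun s hs => ⟨hs.1, (hdir s hs.1).elim (fun h => absurd h.1 hs.2.ne') And.right⟩)

end Predicate

theorem one_le_incircleDegree (k : SiteKind) (n : ℕ) : 1 ≤ incircleDegree k n := by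
  unfold incircleDegree
  split <;> norm_num

theorem incircleDegree_le_six (k : SiteKind) (n : ℕ) : incircleDegree k n ≤ 6 := by
  unfold incircleDegree
  split <;> norm_num

theorem incircleDegree_point_le_segment (n : ℕ) :
    incircleDegree SiteKind.point n ≤ incircleDegree SiteKind.segment n := by
  rcases n with _ | _ | _ | n <;> simp [incircleDegree]

/-- Rotations bring the sites into the order in which points precede segments. -/
theorem VoronoiFamily.circleDec {X σ : Type} {x : X → σ → ℝ} {dom : X → Prop}
    {S₁ S₂ S₃ : X → VSite} {K : X → EPlane} {ρ : X → ℝ}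
    (h : VoronoiFamily x dom S₁ S₂ S₃ K ρ) {k₁ k₂ k₃ : SiteKind}
    (h₁ : ∀ s, dom s → (S₁ s).kind = k₁) (h₂ : ∀ s, dom s → (S₂ s).kind = k₂)
    (h₃ : ∀ s, dom s → (S₃ s).kind = k₃)
    (haxes₁ : ∀ s, dom s → (S₁ s).AxesAligned) (haxes₂ : ∀ s, dom s → (S₂ s).AxesAligned)
    (haxes₃ : ∀ s, dom s → (S₃ s).AxesAligned) :
    CircleDec x (incircleDegree SiteKind.point (k₁.segCount + k₂.segCount + k₃.segCount))
      (incircleDegree SiteKind.segment (k₁.segCount + k₂.segCount + k₃.segCount)) dom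
      (fun s => K s 0) (fun s => K s 1) ρ := by
  cases k₁ <;> cases k₂ <;> cases k₃
  · exact h.circleDec_ppp h₁ h₂ h₃
  · exact h.circleDec_pps h₁ h₂ h₃ haxes₃
  · exact h.rotate.rotate.circleDec_pps h₃ h₁ h₂ haxes₂
  · exact (h.circleDec_pss h₁ h₂ h₃ haxes₂ haxes₃).mono le_rfl (by decide)
  · exact h.rotate.circleDec_pps h₂ h₃ h₁ haxes₁
  · exact (h.rotate.circleDec_pss h₂ h₃ h₁ haxes₃ haxes₁).mono le_rfl (by decide)
  · exact (h.rotate.rotate.circleDec_pss h₃ h₁ h₂ haxes₁ haxes₂).mono le_rfl (by decide)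
  · exact (h.circleDec_sss h₁ h₂ h₃ haxes₁ haxes₂ haxes₃).mono le_rfl (by decide)

theorem incircleDecidableInDegree (k₁ k₂ k₃ kO : SiteKind) :
    IncircleDecidableInDegree k₁ k₂ k₃ kO
      (incircleDegree kO (k₁.segCount + k₂.segCount + k₃.segCount)) := by
  let X := (Fin 4 → VSite) × EPlane × ℝ
  let x : X → Fin 4 × Fin 2 × Fin 2 → ℝ := fun s => inputCoords (s.1 0) (s.1 1) (s.1 2) (s.1 3)
  let dom : X → Prop := fun s =>
    ((s.1 0).kind = k₁ ∧ (s.1 1).kind = k₂ ∧ (s.1 2).kind = k₃ ∧ (s.1 3).kind = kO) ∧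
    (∀ m, (s.1 m).AxesAligned) ∧
    (Disjoint (s.1 0).carrier (s.1 1).carrier ∧ Disjoint (s.1 1).carrier (s.1 2).carrier ∧
      Disjoint (s.1 0).carrier (s.1 2).carrier) ∧
    IsVoronoiCircle (s.1 0) (s.1 1) (s.1 2) s.2.1 s.2.2
  have hpoly : ∀ m e k, PolyFn x 1 (fun s => (s.1 m).coord e k) := fun m e k => by
    have h : PolyFn x 1 _ := PolyFn.var (m, e, k)
    fin_cases m <;> exact h
  have hfam : VoronoiFamily x dom (fun s => s.1 0) (fun s => s.1 1) (fun s => s.1 2)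
      (fun s => s.2.1) (fun s => s.2.2) :=
    { poly₁ := hpoly 0
      poly₂ := hpoly 1
      poly₃ := hpoly 2
      disj₁₂ := fun s hs => hs.2.2.1.1
      disj₂₃ := fun s hs => hs.2.2.1.2.1
      disj₃₁ := fun s hs => hs.2.2.1.2.2.symm
      circle := fun s hs => hs.2.2.2 }
  have hρ : ∀ s, dom s → 0 < s.2.2 := fun s hs => hs.2.2.2.1
  have hcirc := hfam.circleDec (fun s hs => hs.1.1) (fun s hs => hs.1.2.1)
    (fun s hs => hs.1.2.2.1) (fun s hs => hs.2.1 0) (fun s hs => hs.2.1 1) (fun s hs => hs.2.1 2)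
  have key : SignDec x (incircleDegree kO (k₁.segCount + k₂.segCount + k₃.segCount)) dom
      (fun s => incircleValue s.2.1 s.2.2 (s.1 3)) := by
    cases kO
    · exact hcirc.incircle_point hρ (hpoly 3) fun s hs => hs.1.2.2.2
    · exact hcirc.incircle_segment (incircleDegree_point_le_segment _) (one_le_incircleDegree _ _)
        hρ (hpoly 3) (fun s hs => hs.2.1 3) fun s hs => hs.1.2.2.2
  obtain ⟨t, ht, heval⟩ := key
  refine ⟨t, ht, fun S₁ S₂ S₃ O hk₁ hk₂ hk₃ hkO ha₁ ha₂ ha₃ haO hd₁₂ hd₂₃ hd₁₃ K ρ hcircle =>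
    heval (![S₁, S₂, S₃, O], K, ρ) ⟨⟨hk₁, hk₂, hk₃, hkO⟩, fun m => ?_, ⟨hd₁₂, hd₂₃, hd₁₃⟩, hcircle⟩⟩
  fin_cases m
  exacts [ha₁, ha₂, ha₃, haO]

theorem mainTheorem1 :
    (∀ k₁ k₂ k₃ kO : SiteKind, IncircleDecidableInDegree k₁ k₂ k₃ kO 6) ∧
    (∀ k₁ k₂ k₃ kO : SiteKind,
      IncircleDecidableInDegree k₁ k₂ k₃ kO
        (incircleDegree kO (k₁.segCount + k₂.segCount + k₃.segCount))) := by
  refine ⟨fun k₁ k₂ k₃ kO => ?_, incircleDecidableInDegree⟩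
  obtain ⟨t, ht, h⟩ := incircleDecidableInDegree k₁ k₂ k₃ kO
  exact ⟨t, ht.mono (incircleDegree_le_six _ _), h⟩
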